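/- Let $t_0>0$ and let $H$ be a real-valued harmonic function on $\mathbb C\setminus P$, where $\partial H=\tfrac12(\partial_x-i\partial_y)H$ is a rational function and $P\subset\mathbb C$ is its finite set of poles. Put $Q(z)=\frac1{t_0}\big(|z|^2-H(z)\big)$, and write $dA=d^2z/\pi$. Let the compact set $K\subset\mathbb C$ be a connected local droplet of $Q$ of area $\pi t_0$. That is, for some open $U\supset K$, the measure $(\partial\bar\partial Q)\,\mathbf 1_K\,dA$ has support $K$ and minimises $$I_Q[\mu]=\iint\log\frac1{|z-w|}\,d\mu(z)\,d\mu(w)+\int Q\,d\mu$$ among the probability measures of finite energy carried by $\overline U$. Let $\Omega_\infty$ be the unbounded component of $K^c$ (with $\infty\in\Omega_\infty$) and $\Gamma=\partial\Omega_\infty$. Let $\phi$ be the conformal map of $\Omega_\infty$ onto $\{|w|>1\}\cup\{\infty\}$ with $\phi(\infty)=\infty$ and $\phi'(\infty)>0$, and assume that $\phi$ extends to a conformal map of an open neighbourhood $V$ of $\overline\Omega_\infty$. Then there are an open neighbourhood $V_0\subset V$ of $\overline\Omega_\infty$, with $V_0\setminus P$ connected, and a Schwarz function $S_{\Omega_\infty}$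 of $\Omega_\infty$ (meromorphic in $\Omega_\infty$, continuous up to $\Gamma$, and equal to $\bar z$ on $\Gamma$) that extends holomorphically to $V_0\setminus P$, with the following properties. (a) On $V_0$ there is a bounded holomorphic function $\mathcal Q$ with $\operatorname{Re}\mathcal Q=Q$ on $\Gamma$ and $\operatorname{Im}\mathcal Q(\infty)=0$. (b) Let $W\subset V_0$ be any connected open neighbourhood of $\overline\Omega_\infty$, and let $\mathcal Q$ be any bounded holomorphic function on $W$ with $\operatorname{Re}\mathcal Q=Q$ on $\Gamma$ and $\operatorname{Im}\mathcal Q(\infty)=0$. Then $R=Q-\operatorname{Re}\mathcal Q-2\log|\phi|$ is real-analytic on $W\setminus P$. Moreover, for all $z_0\in\Gamma$ and $z\in W\setminus P$, $$R(z)=\frac1{t_0}\Big(|z|^2-|z_0|^2-2\operatorname{Re}\int_{z_0}^zS_{\Omega_\infty}(u)\,du\Big),$$ $$\mathcal Q(z)=\mathcal Q(z_0)+\frac2{t_0}\int_{z_0}^z\big(S_{\Omega_\infty}(u)-\partial H(u)\big)\,du-2\int_{z_0}^z\frac{\phi'(u)}{\phi(u)}\,du,$$ where, in each formula, the integrals are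 taken along any $C^1$ path in $V_0\setminus P$ from $z_0$ to $z$ (the same path for both integrals in the second formula). -/

import Mathlib

open MeasureTheory Set Filter Topology Complex

noncomputable section

namespace HeleShaw

/-! ### Algebraic Hele-Shaw potentials -/

/-- The Wirtinger derivative `∂ = (∂_x - i ∂_y) / 2` of a real-valued function on the plane. -/
def wirtinger (f : ℂ → ℝ) (z : ℂ) : ℂ :=
  ((fderiv ℝ f z 1 : ℂ) - I * (fderiv ℝ f z I : ℂ)) / 2

/-- The poles in `ℂ` of a rational function (its denominator is coprime to its numerator). -/
def poles (h : RatFunc ℂ) : Set ℂ := {z | h.denom.eval z = 0}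

/-- `H` is a real harmonic function off the poles of the rational function `h`, and `∂H = h`.
The values of `H` at the (finitely many) poles are irrelevant. -/
structure IsHarmonicWithRationalDerivative (H : ℂ → ℝ) (h : RatFunc ℂ) : Prop where
  harmonic : InnerProductSpace.HarmonicOnNhd H (poles h)ᶜ
  deriv_eq : ∀ z ∉ poles h, wirtinger H z = h.eval (RingHom.id ℂ) z

/-- The potential `Q(z) = (|z|² - H(z)) / t₀`. -/
def potential (t₀ : ℝ) (H : ℂ → ℝ) (z : ℂ) : ℝ := (‖z‖ ^ 2 - H z) / t₀

/-! ### Weighted logarithmic energy and droplets -/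

/-- Measures for which both terms of the weighted logarithmic energy are finite. A measure with an
atom has infinite logarithmic energy; this is required separately because `Real.log 0 = 0`. -/
structure HasFiniteEnergy (Q : ℂ → ℝ) (ν : Measure ℂ) : Prop where
  noAtoms : NullSingletonClass ν
  integrable_log : Integrable (fun p : ℂ × ℂ => Real.log ‖p.1 - p.2‖) (ν.prod ν)
  integrable_potential : Integrable Q ν

/-- The energy `I_Q[ν] = ∬ log (1 / |z - w|) dν(z) dν(w) + ∫ Q dν`. -/
def energy (Q : ℂ → ℝ) (ν : Measure ℂ) : ℝ :=
  (∫ p : ℂ × ℂ, Real.log (1 / ‖p.1 - p.2‖) ∂(ν.prod ν)) + ∫ z, Q z ∂ν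

/-- `μ` is the equilibrium measure of the localised potential that is `Q` on `X` and `+∞` off `X`:
a probability measure of finite energy carried by `X`, of least energy among all such measures. -/
structure IsEquilibriumMeasure (Q : ℂ → ℝ) (X : Set ℂ) (μ : Measure ℂ) : Prop where
  prob : IsProbabilityMeasure μ
  carried : μ Xᶜ = 0
  finite : HasFiniteEnergy Q μ
  minimal : ∀ ν : Measure ℂ, IsProbabilityMeasure ν → ν Xᶜ = 0 → HasFiniteEnergy Q ν →
    energy Q μ ≤ energy Q ν

/-- The measure `∂∂̄Q · 1_K · dA`, where `∂∂̄` is a quarter of the usual Laplacian and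
`dA` is Lebesgue measure divided by `π`. -/
def dropletMeasure (Q : ℂ → ℝ) (K : Set ℂ) : Measure ℂ :=
  (volume.restrict K).withDensity
    (fun z => ENNReal.ofReal (Laplacian.laplacian Q z / 4 / Real.pi))

/-- The compact set `K` is the droplet of the potential that is `Q` on `X` and `+∞` off `X`: the
equilibrium measure is `∂∂̄Q · 1_K · dA`, and `K` is its support. -/
structure IsDroplet (Q : ℂ → ℝ) (X K : Set ℂ) : Prop where
  isCompact : IsCompact K
  equilibrium : IsEquilibriumMeasure Q X (dropletMeasure Q K)
  support_eq : (dropletMeasure Q K).support = K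

/-- `K` is a local droplet of `Q`: it is the droplet of the localisation of `Q` to the closure of
some open neighbourhood of `K`. -/
def IsLocalDroplet (Q : ℂ → ℝ) (K : Set ℂ) : Prop :=
  ∃ U : Set ℂ, IsOpen U ∧ K ⊆ U ∧ IsDroplet Q (closure U) K

/-! ### The exterior domain and its conformal map -/

/-- The unbounded component of the complement of the compact set `K` (without the point `∞`). -/
def outerDomain (K : Set ℂ) : Set ℂ :=
  {z | z ∈ Kᶜ ∧ ¬ Bornology.IsBounded (connectedComponentIn Kᶜ z)}

/-- `φ` is the conformal map of `Ω ∪ {∞}` onto `{|w| > 1} ∪ {∞}` with `φ(∞) = ∞` and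
`φ'(∞) > 0`, and it extends to a conformal (injective holomorphic) map of the open
neighbourhood `V` of the closure of `Ω`. -/
structure IsExteriorConformalMap (Ω V : Set ℂ) (φ : ℂ → ℂ) : Prop where
  isOpen : IsOpen V
  closure_subset : closure Ω ⊆ V
  holomorphic : DifferentiableOn ℂ φ V
  injOn : InjOn φ V
  bijOn : BijOn φ Ω {w | 1 < ‖w‖}
  normalised : ∃ c : ℝ, 0 < c ∧ Tendsto (fun z => φ z / z) (Bornology.cobounded ℂ) (𝓝 (c : ℂ))

/-- `S` is the Schwarz function of the domain `Ω`, where an unbounded `Ω ⊆ ℂ` stands for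
`Ω ∪ {∞}`: it is meromorphic in `Ω` (also at `∞` if `Ω` is unbounded), continuous up to the
boundary, and equal to `z̄` there. Poles carry the value `0` (meromorphic normal form). -/
structure IsSchwarzFunction (Ω : Set ℂ) (S : ℂ → ℂ) : Prop where
  isOpen : IsOpen Ω
  isConnected : IsConnected Ω
  interior_closure : interior (closure Ω) = Ω
  meromorphic : MeromorphicNFOn S Ω
  at_infinity : ¬ Bornology.IsBounded Ω →
    Bornology.IsBounded Ωᶜ ∧ MeromorphicAt (fun z => S z⁻¹) 0
  continuous_boundary : ∀ z ∈ frontier Ω, ContinuousWithinAt S (closure Ω) z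
  eq_conj : ∀ z ∈ frontier Ω, S z = (starRingEnd ℂ) z

/-- `q` is a bounded holomorphic function on the neighbourhood `W` of the closure of the unbounded
domain `Ω`, with `Re q = Q` on the boundary of `Ω` and `Im q(∞) = 0`. -/
structure IsHarmonicContinuation (Q : ℂ → ℝ) (Ω W : Set ℂ) (q : ℂ → ℂ) : Prop where
  isOpen : IsOpen W
  closure_subset : closure Ω ⊆ W
  holomorphic : DifferentiableOn ℂ q W
  bounded : ∃ M : ℝ, ∀ z ∈ W, ‖q z‖ ≤ M
  re_eq : ∀ z ∈ frontier Ω, (q z).re = Q z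
  im_infinity : Tendsto (fun z => (q z).im) (Bornology.cobounded ℂ) (𝓝 0)

/-- The function `R = Q - Re q - 2 log |φ|`. -/
def remainder (Q : ℂ → ℝ) (q φ : ℂ → ℂ) (z : ℂ) : ℝ :=
  Q z - (q z).re - 2 * Real.log ‖φ z‖

/-! ### Path integrals -/

/-- `γ`, restricted to `[0, 1]`, is a `C¹` path in `D` from `a` to `b`. -/
structure IsPathIn (D : Set ℂ) (a b : ℂ) (γ : ℝ → ℂ) : Prop where
  contDiffOn : ContDiffOn ℝ 1 γ (Icc 0 1)
  mapsTo : MapsTo γ (Icc 0 1) D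
  source : γ 0 = a
  target : γ 1 = b

/-- The complex line integral `∫_γ f(u) du`. -/
def pathIntegral (f : ℂ → ℂ) (γ : ℝ → ℂ) : ℂ :=
  ∫ t in (0 : ℝ)..1, f (γ t) * deriv γ t

end HeleShaw

end

/-! The equilibrium condition turns into an identity for the Cauchy transform `C(z) = ∫ dμ(w)/(z -
w)` of the equilibrium measure `μ`. Move `μ` by `z ↦ z + ε v(z)`, with `v` Lipschitz and compactly
supported in `U` minus the poles. For small `ε` of either sign the image is still an admissible
competitor, so the derivative of the energy at `ε = 0` vanishes (`first_variation_eq_zero`).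
Symmetrising the double integral and letting `v` vary gives `∂Q = C` almost everywhere for `μ` on
`U` off the poles (`ae_wirtinger_eq_cauchyTransform`). Since `μ` has bounded density, `C` is
continuous; clearing the denominator of `∂H` then upgrades this to every point of the support `K`.
Hence `K` contains no pole, and `∂H + t₀ C = z̄` on `K` (`IsLocalDroplet.eval_eq`).

The boundary `Γ` lies in `K` and `C` is holomorphic off `K`, so `∂H + t₀ C` is a Schwarz function of
the exterior domain. To cross `Γ`, let `ψ(ζ) = φ⁻¹(1/ζ)`. The conjugated reflection `conj (ψ (conj
φ))` is holomorphic on both sides of `Γ` and equals `z̄` on it, so it agrees with the Schwarz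
function outside and continues it inside (`ExteriorChart.eq_reflection`,
`ExteriorChart.exists_isSchwarzFunction`).

For (a), `B = (S - ∂H)/t₀` equals `C` outside `K`, so it has no poles there and `z B(z) → 1` at
infinity. The simple pole of `2 B dz` at infinity is cancelled by `2 dφ/φ`, and the difference has a
primitive in the disc coordinate `1/φ` (`ExteriorChart.exists_primitive`). With this primitive as
`q`, the differential of `R` is `Re ((2/t₀)(z̄ - S) dz)`, which vanishes on `Γ`. So `R` is constant
on `Γ`, and an additive constant in `q` yields the prescribed normalisation.

For (b), the maximum principle and the identity theorem make `q` unique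
(`ExteriorChart.eqOn_of_isHarmonicContinuation`). It is therefore the function constructed for (a),
and both formulas follow by integrating known differentials along the path. -/

namespace HeleShaw

/-! ### The Cauchy transform -/

/-- The Cauchy transform `∫ dμ(w) / (z - w)` of a measure on the plane. -/
noncomputable def cauchyTransform (μ : Measure ℂ) (z : ℂ) : ℂ := ∫ w, (z - w)⁻¹ ∂μ

theorem cauchyTransform_eq_neg_resolventTransform (μ : Measure ℂ) (z : ℂ) :
    cauchyTransform μ z = -resolventTransform μ z := by
  rw [cauchyTransform, resolventTransform_apply, ← integral_neg]
  congr 1 with w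
  simp [resolvent, Ring.inverse_eq_inv, ← inv_neg]

theorem differentiableOn_cauchyTransform (μ : Measure ℂ) [IsFiniteMeasure μ] :
    DifferentiableOn ℂ (cauchyTransform μ) μ.supportᶜ := by
  have h := (analyticOn_resolventTransform (μ := μ)).differentiableOn.neg
  simp only [Algebra.algebraMap_self, RingHom.id_apply, image_id'] at h
  exact h.congr fun z _ => cauchyTransform_eq_neg_resolventTransform μ z

theorem integrableOn_inv_ball (r : ℝ) :
    IntegrableOn (fun u : ℂ => u⁻¹) (Metric.ball 0 r) := by
  refine integrableOn_ball_of_norm_le_rpow (C := 1) (α := 1) (by simp) (by simp)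
    (ae_of_all _ fun x => ?_) (by fun_prop)
  simp [Real.rpow_neg_one]

theorem tendsto_lintegral_inv_ball :
    Tendsto (fun r : ℝ => ∫⁻ u in Metric.ball (0 : ℂ) r, ‖u⁻¹‖ₑ) (𝓝[>] 0) (𝓝 0) := by
  have h1 : (∫⁻ u in Metric.ball (0 : ℂ) 1, ‖u⁻¹‖ₑ) ≠ ⊤ :=
    (integrableOn_inv_ball 1).hasFiniteIntegral.ne
  have h2 := tendsto_setLIntegral_zero (μ := volume.restrict (Metric.ball (0 : ℂ) 1))
    (ι := ℝ) (l := 𝓝[>] 0) (s := fun r => Metric.ball (0 : ℂ) r) h1 ?_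
  · refine h2.congr' ?_
    filter_upwards [Ioo_mem_nhdsGT (show (0 : ℝ) < 1 by norm_num)] with r hr
    rw [Measure.restrict_restrict measurableSet_ball,
      inter_eq_left.2 (Metric.ball_subset_ball hr.2.le)]
  · refine tendsto_of_tendsto_of_tendsto_of_le_of_le (g := fun _ => 0)
      (h := fun r : ℝ => volume (Metric.ball (0 : ℂ) r)) tendsto_const_nhds ?_
      (fun _ => zero_le) (fun r => Measure.restrict_apply_le _ _)
    have : Tendsto (fun r : ℝ => ENNReal.ofReal r ^ 2 * NNReal.pi) (𝓝[>] 0)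
        (𝓝 (ENNReal.ofReal 0 ^ 2 * NNReal.pi)) := by
      refine ENNReal.Tendsto.mul_const (ENNReal.Tendsto.pow ?_) (by simp)
      exact (ENNReal.continuous_ofReal.tendsto 0).mono_left nhdsWithin_le_nhds
    simpa [Complex.volume_ball] using this

/-- After comparison with Lebesgue measure, the substitution `u = z - w` removes `z` from the bound;
this uniformity is what makes the Cauchy transform continuous. -/
theorem lintegral_ball_inv_le {μ : Measure ℂ} {c : ENNReal} (hμ : μ ≤ c • volume)
    (z : ℂ) (r : ℝ) :
    ∫⁻ w in Metric.ball z r, ‖(z - w)⁻¹‖ₑ ∂μ ≤ c * ∫⁻ u in Metric.ball (0 : ℂ) r, ‖u⁻¹‖ₑ := by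
  calc ∫⁻ w in Metric.ball z r, ‖(z - w)⁻¹‖ₑ ∂μ
      ≤ ∫⁻ w in Metric.ball z r, ‖(z - w)⁻¹‖ₑ ∂(c • volume) :=
        lintegral_mono' (Measure.restrict_mono_measure hμ _) le_rfl
    _ = c * ∫⁻ w in Metric.ball z r, ‖(z - w)⁻¹‖ₑ := by
        rw [Measure.restrict_smul, lintegral_smul_measure, smul_eq_mul]
    _ = c * ∫⁻ u in Metric.ball (0 : ℂ) r, ‖u⁻¹‖ₑ := by
        congr 1
        rw [← lintegral_indicator measurableSet_ball, ← lintegral_indicator measurableSet_ball,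
          ← lintegral_sub_left_eq_self _ z]
        congr 1 with w
        by_cases hw : w ∈ Metric.ball 0 r
        · rw [indicator_of_mem hw, indicator_of_mem, sub_sub_cancel]
          simpa [dist_eq_norm, norm_sub_rev] using hw
        · rw [indicator_of_notMem hw, indicator_of_notMem]
          simpa [dist_eq_norm, norm_sub_rev] using hw

/-- Split at distance 1 from `z`: the bounded density controls the near part, and the kernel is at
most 1 on the far part. -/
theorem exists_lintegral_inv_le {μ : Measure ℂ} [IsFiniteMeasure μ] {c : ENNReal} (hc : c ≠ ⊤)
    (hμ : μ ≤ c • volume) : ∃ B : ENNReal, B ≠ ⊤ ∧ ∀ z, ∫⁻ w, ‖(z - w)⁻¹‖ₑ ∂μ ≤ B := by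
  refine ⟨c * (∫⁻ u in Metric.ball (0 : ℂ) 1, ‖u⁻¹‖ₑ) + μ univ, ?_, fun z => ?_⟩
  · have := (integrableOn_inv_ball 1).hasFiniteIntegral.ne
    exact ENNReal.add_ne_top.2 ⟨ENNReal.mul_ne_top hc this, by simp⟩
  rw [← lintegral_add_compl _ (measurableSet_ball (x := z) (ε := 1))]
  gcongr
  · exact lintegral_ball_inv_le hμ z 1
  · calc ∫⁻ w in (Metric.ball z 1)ᶜ, ‖(z - w)⁻¹‖ₑ ∂μ
        ≤ ∫⁻ w in (Metric.ball z 1)ᶜ, 1 ∂μ := by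
          refine setLIntegral_mono measurable_const fun w hw => ?_
          have : 1 ≤ ‖z - w‖ := by simpa [dist_eq_norm, norm_sub_rev] using hw
          rw [enorm_eq_nnnorm]
          norm_cast
          rw [nnnorm_inv]
          exact inv_le_one_of_one_le₀ (by exact_mod_cast this)
      _ ≤ μ univ := by simpa using measure_mono (subset_univ _)

theorem integrable_inv_sub {μ : Measure ℂ} [IsFiniteMeasure μ] {c : ENNReal} (hc : c ≠ ⊤)
    (hμ : μ ≤ c • volume) (z : ℂ) : Integrable (fun w => (z - w)⁻¹) μ := by
  obtain ⟨B, hB, h⟩ := exists_lintegral_inv_le hc hμ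
  exact ⟨by fun_prop, (h z).trans_lt hB.lt_top⟩

theorem integrable_prod_inv_sub {μ : Measure ℂ} [IsFiniteMeasure μ] {c : ENNReal} (hc : c ≠ ⊤)
    (hμ : μ ≤ c • volume) : Integrable (fun p : ℂ × ℂ => (p.1 - p.2)⁻¹) (μ.prod μ) := by
  obtain ⟨B, hB, h⟩ := exists_lintegral_inv_le hc hμ
  refine ⟨by fun_prop, ?_⟩
  rw [HasFiniteIntegral, lintegral_prod _ (by fun_prop)]
  refine (lintegral_mono h).trans_lt ?_
  simpa using ENNReal.mul_lt_top hB.lt_top (measure_lt_top μ univ)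

/-- A continuous truncation of the kernel `1 / u`. -/
noncomputable def truncatedInv (r : ℝ) (u : ℂ) : ℂ :=
  (starRingEnd ℂ) u / ((max (‖u‖ ^ 2) (r ^ 2) : ℝ) : ℂ)

theorem continuous_truncatedInv {r : ℝ} (hr : 0 < r) : Continuous (truncatedInv r) := by
  unfold truncatedInv
  refine continuous_conj.div (by fun_prop) fun u => ?_
  have : 0 < max (‖u‖ ^ 2) (r ^ 2) := lt_max_of_lt_right (by positivity)
  exact_mod_cast this.ne'

theorem norm_truncatedInv_le {r : ℝ} (hr : 0 < r) (u : ℂ) : ‖truncatedInv r u‖ ≤ r⁻¹ := by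
  have h : 0 < max (‖u‖ ^ 2) (r ^ 2) := lt_max_of_lt_right (by positivity)
  rw [truncatedInv, norm_div, norm_real, Real.norm_of_nonneg h.le, RCLike.norm_conj,
    div_le_iff₀ h]
  rcases le_total ‖u‖ r with h1 | h1
  · calc ‖u‖ ≤ r⁻¹ * r ^ 2 := by field_simp; exact h1
      _ ≤ _ := by gcongr; exact le_max_right _ _
  · calc ‖u‖ ≤ r⁻¹ * ‖u‖ ^ 2 := by
          field_simp; nlinarith [norm_nonneg u]
      _ ≤ _ := by gcongr; exact le_max_left _ _

theorem truncatedInv_of_le {r : ℝ} {u : ℂ} (hr : 0 < r) (hu : r ≤ ‖u‖) :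
    truncatedInv r u = u⁻¹ := by
  have h : max (‖u‖ ^ 2) (r ^ 2) = ‖u‖ ^ 2 := max_eq_left (by gcongr)
  rw [truncatedInv, h, Complex.inv_def, Complex.normSq_eq_norm_sq, div_eq_mul_inv, ofReal_inv]

/-- The truncation multiplies `u⁻¹` by a real factor in `[0, 1]`. -/
theorem norm_inv_sub_truncatedInv_le {r : ℝ} (hr : 0 < r) (u : ℂ) :
    ‖u⁻¹ - truncatedInv r u‖ ≤ ‖u⁻¹‖ := by
  rcases eq_or_ne u 0 with rfl | hu
  · simp [truncatedInv]
  have h : 0 < max (‖u‖ ^ 2) (r ^ 2) := lt_max_of_lt_right (by positivity)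
  have h2 : truncatedInv r u = u⁻¹ * ((‖u‖ ^ 2 / max (‖u‖ ^ 2) (r ^ 2) : ℝ) : ℂ) := by
    rw [truncatedInv, Complex.inv_def, Complex.normSq_eq_norm_sq]
    have : (‖u‖ : ℂ) ≠ 0 := by simpa using hu
    push_cast
    field_simp
  have h3 : ‖u‖ ^ 2 / max (‖u‖ ^ 2) (r ^ 2) ≤ 1 := div_le_one_of_le₀ (le_max_left _ _) h.le
  have h4 : 0 ≤ ‖u‖ ^ 2 / max (‖u‖ ^ 2) (r ^ 2) := by positivity
  rw [h2, ← mul_one_sub, norm_mul]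
  refine mul_le_of_le_one_right (norm_nonneg _) ?_
  rw [← ofReal_one, ← ofReal_sub, norm_real, Real.norm_of_nonneg (by linarith)]
  linarith

/-- A uniform limit of continuous functions: replacing the kernel by its truncation at radius `r`
costs at most the integral of `1/|z - w|` over the ball of radius `r` about `z`, which is small
uniformly in `z`. -/
theorem continuous_cauchyTransform {μ : Measure ℂ} [IsFiniteMeasure μ] {c : ENNReal} (hc : c ≠ ⊤)
    (hμ : μ ≤ c • volume) : Continuous (cauchyTransform μ) := by
  refine continuous_of_uniform_approx_of_continuous fun s hs => ?_
  obtain ⟨ε, hε, hs⟩ := _root_.mem_uniformity_edist.1 hs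
  have hlim : Tendsto (fun r : ℝ => c * ∫⁻ u in Metric.ball (0 : ℂ) r, ‖u⁻¹‖ₑ) (𝓝[>] 0)
      (𝓝 (c * 0)) := ENNReal.Tendsto.const_mul tendsto_lintegral_inv_ball (Or.inr hc)
  rw [mul_zero] at hlim
  obtain ⟨r, hrε, hr⟩ := ((hlim.eventually (gt_mem_nhds hε)).and self_mem_nhdsWithin).exists
  have hr : 0 < r := hr
  have hint : ∀ z, Integrable (fun w => truncatedInv r (z - w)) μ := fun z =>
    Integrable.of_bound
      ((continuous_truncatedInv hr).comp (by fun_prop)).aestronglyMeasurable r⁻¹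
      (ae_of_all _ fun w => norm_truncatedInv_le hr _)
  refine ⟨fun z => ∫ w, truncatedInv r (z - w) ∂μ, ?_, fun z => hs ?_⟩
  · refine continuous_of_dominated (bound := fun _ => r⁻¹)
      (fun z => (hint z).aestronglyMeasurable)
      (fun z => ae_of_all _ fun w => norm_truncatedInv_le hr _) (integrable_const _)
      (ae_of_all _ fun w => (continuous_truncatedInv hr).comp (by fun_prop))
  · rw [edist_eq_enorm_sub, cauchyTransform,
      ← integral_sub (integrable_inv_sub hc hμ z) (hint z)]
    refine lt_of_le_of_lt ?_ hrε
    calc ‖∫ w, ((z - w)⁻¹ - truncatedInv r (z - w)) ∂μ‖ₑ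
        ≤ ∫⁻ w, ‖(z - w)⁻¹ - truncatedInv r (z - w)‖ₑ ∂μ := enorm_integral_le_lintegral_enorm _
      _ ≤ ∫⁻ w, (Metric.ball z r).indicator (fun w => ‖(z - w)⁻¹‖ₑ) w ∂μ := by
          refine lintegral_mono fun w => ?_
          by_cases hw : w ∈ Metric.ball z r
          · rw [indicator_of_mem hw]
            exact enorm_le_iff_norm_le.2 (norm_inv_sub_truncatedInv_le hr _)
          · rw [truncatedInv_of_le hr (by simpa [dist_eq_norm, norm_sub_rev] using hw)]
            simp
      _ ≤ _ := by
          rw [lintegral_indicator measurableSet_ball]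
          exact lintegral_ball_inv_le hμ z r

/-- Dominated convergence: `z/(z - w) → 1`, with modulus at most 2 once `|z|` is twice the radius of
a disc containing `K`. -/
theorem tendsto_mul_cauchyTransform {μ : Measure ℂ} [IsProbabilityMeasure μ] {K : Set ℂ}
    (hK : IsCompact K) (hμK : μ Kᶜ = 0) :
    Tendsto (fun z => z * cauchyTransform μ z) (Bornology.cobounded ℂ) (𝓝 1) := by
  obtain ⟨R, hR0, hR⟩ := hK.isBounded.exists_pos_norm_le
  have hae : ∀ᵐ w ∂μ, w ∈ K := by
    rw [ae_iff]; exact hμK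
  have h1 : Tendsto (fun z : ℂ => ∫ w, z * (z - w)⁻¹ ∂μ) (Bornology.cobounded ℂ)
      (𝓝 (∫ _, (1 : ℂ) ∂μ)) := by
    have : (Bornology.cobounded ℂ).IsCountablyGenerated := by
      rw [← comap_norm_atTop]; infer_instance
    refine tendsto_integral_filter_of_dominated_convergence (fun _ => 2)
      (Eventually.of_forall fun z => by fun_prop) ?_ (integrable_const _) ?_
    · filter_upwards [tendsto_norm_cobounded_atTop.eventually (eventually_ge_atTop (2 * R))]
        with z hz
      filter_upwards [hae] with w hw
      have h2 : ‖z‖ - ‖w‖ ≤ ‖z - w‖ := norm_sub_norm_le _ _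
      have h3 := hR w hw
      rw [norm_mul, norm_inv, ← div_eq_mul_inv, div_le_iff₀ (by linarith)]
      linarith
    · filter_upwards with w
      have h2 : Tendsto (fun z : ℂ => (1 - w * z⁻¹)⁻¹) (Bornology.cobounded ℂ)
          (𝓝 (1 - w * 0)⁻¹) := by
        refine Tendsto.inv₀ (tendsto_const_nhds.sub (tendsto_inv₀_cobounded.const_mul w)) (by simp)
      simp only [mul_zero, sub_zero, inv_one] at h2
      refine h2.congr' ?_
      filter_upwards [tendsto_norm_cobounded_atTop.eventually (eventually_gt_atTop 0)] with z hz
      have hz : z ≠ 0 := norm_pos_iff.1 hz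
      have : 1 - w * z⁻¹ = (z - w) * z⁻¹ := by field_simp
      rw [this, mul_inv, inv_inv, mul_comm]
  simpa [cauchyTransform, integral_const_mul] using h1

/-! ### Calculus with real potentials -/

theorem hasDerivAt_log_norm {f : ℝ → ℂ} {f' : ℂ} {t : ℝ} (hf : HasDerivAt f f' t)
    (h0 : f t ≠ 0) : HasDerivAt (fun s => Real.log ‖f s‖) (f' / f t).re t := by
  have h1 := (hf.norm_sq.log (by positivity)).const_mul (1 / 2 : ℝ)
  have h2 : (fun s => Real.log ‖f s‖) = fun s => 1 / 2 * Real.log (‖f s‖ ^ 2) := by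
    ext s; rw [Real.log_pow]; push_cast; ring
  rw [h2]
  convert! h1 using 1
  rw [Complex.inner, div_eq_mul_inv, Complex.inv_def, Complex.normSq_eq_norm_sq,
    ← mul_assoc, re_mul_ofReal, div_eq_mul_inv, mul_comm f']
  ring

theorem fderiv_apply_eq_wirtinger (f : ℂ → ℝ) (z v : ℂ) :
    fderiv ℝ f z v = 2 * (wirtinger f z * v).re := by
  have hv : v = v.re • (1 : ℂ) + v.im • I := by
    apply Complex.ext <;> simp
  conv_lhs => rw [hv, map_add, map_smul, map_smul]
  simp [wirtinger, mul_re, div_eq_mul_inv]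
  norm_num
  ring

theorem measurable_wirtinger (f : ℂ → ℝ) : Measurable (wirtinger f) := by
  have h1 := measurable_fderiv_apply_const ℝ f 1
  have h2 := measurable_fderiv_apply_const ℝ f I
  unfold wirtinger
  fun_prop

/-! ### Variations of the energy -/

/-- The deformation of the plane along a vector field. -/
def deformation (v : ℂ → ℂ) (ε : ℝ) (z : ℂ) : ℂ := z + ε * v z

theorem deformation_zero (v : ℂ → ℂ) : deformation v 0 = id := by
  ext z; simp [deformation]

theorem continuous_deformation {v : ℂ → ℂ} (hv : Continuous v) (ε : ℝ) :
    Continuous (deformation v ε) := by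
  unfold deformation; fun_prop

/-- Together with the upper bound below, this makes small deformations bi-Lipschitz with constant 2.
They are then injective, and change `log |z - w|` by at most `log 2`, so finite energy is preserved.
-/
theorem norm_deformation_sub_ge {v : ℂ → ℂ} {L : NNReal} (hv : LipschitzWith L v) {ε : ℝ}
    (hε : |ε| * L ≤ 1 / 2) (z w : ℂ) :
    ‖z - w‖ / 2 ≤ ‖deformation v ε z - deformation v ε w‖ := by
  have h1 : deformation v ε z - deformation v ε w = (z - w) - -(ε * (v z - v w)) := by
    simp only [deformation]; ring
  have h2 : ‖(ε : ℂ) * (v z - v w)‖ ≤ |ε| * (L * ‖z - w‖) := by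
    rw [norm_mul, norm_real, Real.norm_eq_abs]
    gcongr
    exact hv.norm_sub_le z w
  have h3 := norm_sub_norm_le (z - w) (-(ε * (v z - v w)))
  rw [norm_neg] at h3
  rw [h1]
  nlinarith [norm_nonneg (z - w)]

theorem norm_deformation_sub_le {v : ℂ → ℂ} {L : NNReal} (hv : LipschitzWith L v) {ε : ℝ}
    (hε : |ε| * L ≤ 1 / 2) (z w : ℂ) :
    ‖deformation v ε z - deformation v ε w‖ ≤ 2 * ‖z - w‖ := by
  have h1 : deformation v ε z - deformation v ε w = (z - w) + (ε * (v z - v w)) := by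
    simp only [deformation]; ring
  have h2 : ‖(ε : ℂ) * (v z - v w)‖ ≤ |ε| * (L * ‖z - w‖) := by
    rw [norm_mul, norm_real, Real.norm_eq_abs]
    gcongr
    exact hv.norm_sub_le z w
  have h3 := norm_add_le (z - w) (ε * (v z - v w))
  rw [h1]
  nlinarith [norm_nonneg (z - w)]

theorem abs_log_norm_deformation_sub_le {v : ℂ → ℂ} {L : NNReal} (hv : LipschitzWith L v) {ε : ℝ}
    (hε : |ε| * L ≤ 1 / 2) (z w : ℂ) :
    |Real.log ‖deformation v ε z - deformation v ε w‖| ≤ |Real.log ‖z - w‖| + Real.log 2 := by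
  have hlog2 : 0 ≤ Real.log 2 := Real.log_nonneg (by norm_num)
  rcases eq_or_ne z w with rfl | hzw
  · simpa using hlog2
  have h0 : 0 < ‖z - w‖ := norm_pos_iff.2 (sub_ne_zero.2 hzw)
  have h1 := norm_deformation_sub_ge hv hε z w
  have h2 := norm_deformation_sub_le hv hε z w
  have h3 := Real.log_le_log (by positivity) h1
  have h4 := Real.log_le_log (by linarith) h2
  rw [Real.log_div h0.ne' two_ne_zero] at h3
  rw [Real.log_mul two_ne_zero h0.ne'] at h4
  rw [abs_le]
  constructor <;> linarith [neg_abs_le (Real.log ‖z - w‖), le_abs_self (Real.log ‖z - w‖)]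

theorem exists_pos_abs_mul_le_half (L : ℝ) :
    ∃ r : ℝ, 0 < r ∧ ∀ ε ∈ Metric.ball (0 : ℝ) r, |ε| * L ≤ 1 / 2 := by
  have h : Tendsto (fun ε : ℝ => |ε| * L) (𝓝 0) (𝓝 (|0| * L)) :=
    (continuous_abs.mul continuous_const).tendsto 0
  rw [abs_zero, zero_mul] at h
  obtain ⟨r, hr, h⟩ := Metric.eventually_nhds_iff_ball.1
    (h.eventually (ge_mem_nhds (show (0 : ℝ) < 1 / 2 by norm_num)))
  exact ⟨r, hr, h⟩

theorem integrable_log_norm_deformation {μ : Measure ℂ} [IsProbabilityMeasure μ]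
    (hμ : Integrable (fun p : ℂ × ℂ => Real.log ‖p.1 - p.2‖) (μ.prod μ))
    {v : ℂ → ℂ} {L : NNReal} (hv : LipschitzWith L v) {ε : ℝ} (hε : |ε| * L ≤ 1 / 2) :
    Integrable (fun p : ℂ × ℂ => Real.log ‖deformation v ε p.1 - deformation v ε p.2‖)
      (μ.prod μ) := by
  have hm : Measurable (deformation v ε) := (continuous_deformation hv.continuous ε).measurable
  refine (hμ.abs.add (integrable_const (Real.log 2))).mono'
    (Measurable.aestronglyMeasurable (by fun_prop)) (ae_of_all _ fun p => ?_)
  exact abs_log_norm_deformation_sub_le hv hε _ _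

theorem hasDerivAt_integral_log_norm_deformation {μ : Measure ℂ} [IsProbabilityMeasure μ]
    (hμ : Integrable (fun p : ℂ × ℂ => Real.log ‖p.1 - p.2‖) (μ.prod μ))
    {v : ℂ → ℂ} {L : NNReal} (hv : LipschitzWith L v) :
    HasDerivAt
      (fun ε => ∫ p : ℂ × ℂ, Real.log ‖deformation v ε p.1 - deformation v ε p.2‖ ∂(μ.prod μ))
      (∫ p : ℂ × ℂ, ((v p.1 - v p.2) / (p.1 - p.2)).re ∂(μ.prod μ)) 0 := by
  have hvm : Measurable v := hv.continuous.measurable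
  obtain ⟨r, hr, hrL⟩ := exists_pos_abs_mul_le_half L
  have key := hasDerivAt_integral_of_dominated_loc_of_deriv_le (μ := μ.prod μ) (𝕜 := ℝ)
    (F := fun ε p => Real.log ‖deformation v ε p.1 - deformation v ε p.2‖)
    (F' := fun ε p =>
      ((v p.1 - v p.2) / (deformation v ε p.1 - deformation v ε p.2)).re) (x₀ := 0)
    (s := Metric.ball 0 r) (bound := fun _ => 2 * (L : ℝ)) (Metric.ball_mem_nhds 0 hr)
    ?_ ?_ ?_ ?_ (integrable_const _) ?_
  · simpa [deformation_zero] using key.2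
  · filter_upwards [Metric.ball_mem_nhds 0 hr] with ε hε
    exact (integrable_log_norm_deformation hμ hv (hrL ε hε)).aestronglyMeasurable
  · exact integrable_log_norm_deformation hμ hv (by simp)
  · simp only [deformation_zero, id]
    exact Measurable.aestronglyMeasurable (by fun_prop)
  -- The numerator is at most `L |z - w|` and the denominator at least `|z - w| / 2`, hence the
  -- dominating constant `2 L`.
  · refine ae_of_all _ fun p ε hε => ?_
    refine (abs_re_le_norm _).trans ?_
    rw [norm_div]
    refine div_le_of_le_mul₀ (norm_nonneg _) (by positivity) ?_
    have h1 := norm_deformation_sub_ge hv (hrL ε hε) p.1 p.2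
    have h2 := hv.norm_sub_le p.1 p.2
    calc _ ≤ _ := h2
      _ = 2 * L * (‖p.1 - p.2‖ / 2) := by ring
      _ ≤ _ := by gcongr
  · refine ae_of_all _ fun p ε hε => ?_
    have hd : HasDerivAt (fun ε : ℝ => deformation v ε p.1 - deformation v ε p.2)
        (v p.1 - v p.2) ε := by
      have h1 : ∀ z, HasDerivAt (fun ε : ℝ => deformation v ε z) (v z) ε := fun z => by
        simpa [deformation] using ((ofRealCLM.hasDerivAt (x := ε)).mul_const (v z)).const_add z
      exact (h1 _).sub (h1 _)
    -- On the diagonal both `Real.log 0` and `0 / 0` are zero, so the derivative formula holds there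
    -- by convention.
    rcases eq_or_ne p.1 p.2 with h | h
    · simpa [h] using hasDerivAt_const ε (0 : ℝ)
    · refine hasDerivAt_log_norm hd (norm_pos_iff.1 ?_)
      have h1 := norm_deformation_sub_ge hv (hrL ε hε) p.1 p.2
      have h0 : 0 < ‖p.1 - p.2‖ := norm_pos_iff.2 (sub_ne_zero.2 h)
      linarith

/-- Only points of the support of `v` move, and they stay in a compact subset of `D`. There the
derivative of the potential is bounded, which permits differentiation under the integral. -/
theorem exists_deformation_mem {v : ℂ → ℂ} (hv : Continuous v) (hvc : HasCompactSupport v)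
    {D : Set ℂ} (hD : IsOpen D) (hvD : tsupport v ⊆ D) :
    ∃ N ⊆ D, IsCompact N ∧ ∃ r : ℝ, 0 < r ∧ ∀ ε ∈ Metric.ball (0 : ℝ) r, ∀ z ∈ tsupport v,
      deformation v ε z ∈ N := by
  obtain ⟨δ, hδ, hN⟩ := hvc.isCompact.exists_cthickening_subset_open hD hvD
  obtain ⟨M, hM⟩ := hvc.exists_bound_of_continuous hv
  have hM0 : 0 ≤ M := (norm_nonneg _).trans (hM 0)
  refine ⟨_, hN, hvc.isCompact.cthickening, δ / (M + 1), by positivity, fun ε hε z hz => ?_⟩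
  refine Metric.mem_cthickening_of_dist_le _ z _ _ hz ?_
  rw [dist_eq_norm, deformation, add_sub_cancel_left, norm_mul, norm_real]
  have h1 : ‖ε‖ < δ / (M + 1) := by simpa using hε
  calc ‖ε‖ * ‖v z‖ ≤ δ / (M + 1) * (M + 1) := by
        gcongr; linarith [hM z]
    _ = δ := by field_simp

theorem hasDerivAt_integral_comp_deformation {μ : Measure ℂ} [IsProbabilityMeasure μ]
    {Q : ℂ → ℝ} (hQm : Measurable Q) (hQ : Integrable Q μ) {D : Set ℂ} (hD : IsOpen D)
    (hQD : ContDiffOn ℝ 1 Q D) {v : ℂ → ℂ} (hv : Continuous v) (hvc : HasCompactSupport v)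
    (hvD : tsupport v ⊆ D) :
    HasDerivAt (fun ε => ∫ z, Q (deformation v ε z) ∂μ)
      (∫ z, 2 * (wirtinger Q z * v z).re ∂μ) 0 ∧
    ∀ᶠ ε in 𝓝 (0 : ℝ), Integrable (fun z => Q (deformation v ε z)) μ := by
  obtain ⟨N, hND, hNc, r, hr, hrN⟩ := exists_deformation_mem hv hvc hD hvD
  obtain ⟨M, hM⟩ := hvc.exists_bound_of_continuous hv
  have hM0 : 0 ≤ M := (norm_nonneg _).trans (hM 0)
  obtain ⟨B, hB⟩ := hNc.exists_bound_of_continuousOn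
    ((hQD.continuousOn_fderiv_of_isOpen hD le_rfl).mono hND)
  have hdm : ∀ ε, Measurable (deformation v ε) := fun ε =>
    (continuous_deformation hv ε).measurable
  have hw := measurable_wirtinger Q
  have hvm := hv.measurable
  have hzero : ∀ z, z ∉ tsupport v → v z = 0 := fun z hz => image_eq_zero_of_notMem_tsupport hz
  have hderiv : ∀ z, ∀ ε ∈ Metric.ball (0 : ℝ) r,
      HasDerivAt (fun ε => Q (deformation v ε z))
        (2 * (wirtinger Q (deformation v ε z) * v z).re) ε := by
    intro z ε hε
    by_cases hz : z ∈ tsupport v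
    · have hmem := hND (hrN ε hε z hz)
      have h1 : HasFDerivAt Q (fderiv ℝ Q (deformation v ε z)) (deformation v ε z) :=
        ((hQD.differentiableOn one_ne_zero).differentiableAt (hD.mem_nhds hmem)).hasFDerivAt
      have h2 : HasDerivAt (fun ε : ℝ => deformation v ε z) (v z) ε := by
        simpa [deformation] using ((ofRealCLM.hasDerivAt (x := ε)).mul_const (v z)).const_add z
      rw [← fderiv_apply_eq_wirtinger]
      exact h1.comp_hasDerivAt ε h2
    · simpa [deformation, hzero z hz] using hasDerivAt_const ε (Q z)
  have hbound : ∀ z, ∀ ε ∈ Metric.ball (0 : ℝ) r,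
      ‖2 * (wirtinger Q (deformation v ε z) * v z).re‖ ≤ |B| * M := by
    intro z ε hε
    by_cases hz : z ∈ tsupport v
    · rw [← fderiv_apply_eq_wirtinger]
      refine (ContinuousLinearMap.le_opNorm _ _).trans ?_
      gcongr
      · exact (hB _ (hrN ε hε z hz)).trans (le_abs_self B)
      · exact hM z
    · simp only [hzero z hz, mul_zero, zero_re, norm_zero]
      positivity
  constructor
  · have key := hasDerivAt_integral_of_dominated_loc_of_deriv_le (μ := μ) (𝕜 := ℝ)
      (F := fun ε z => Q (deformation v ε z))
      (F' := fun ε z => 2 * (wirtinger Q (deformation v ε z) * v z).re) (x₀ := 0)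
      (s := Metric.ball 0 r) (bound := fun _ => |B| * M) (Metric.ball_mem_nhds 0 hr)
      (Eventually.of_forall fun ε => (hQm.comp (hdm ε)).aestronglyMeasurable)
      (by simpa [deformation_zero] using hQ)
      (by simp only [deformation_zero, id]; fun_prop)
      (ae_of_all _ hbound) (integrable_const _) (ae_of_all _ hderiv)
    simpa [deformation_zero] using key.2
  · filter_upwards [Metric.ball_mem_nhds 0 hr] with ε hε
    refine (hQ.abs.add (integrable_const (|B| * M * |ε|))).mono'
      (hQm.comp (hdm ε)).aestronglyMeasurable (ae_of_all _ fun z => ?_)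
    -- By the mean value inequality in `ε` the deformed potential differs from `Q` by a bounded
    -- amount, so it stays integrable.
    have h1 := (convex_ball (0 : ℝ) r).norm_image_sub_le_of_norm_hasDerivWithin_le
      (fun ε hε => (hderiv z ε hε).hasDerivWithinAt) (hbound z) (Metric.mem_ball_self hr) hε
    simp only [deformation_zero, id, sub_zero, Real.norm_eq_abs] at h1
    have h2 := abs_sub_abs_le_abs_sub (Q (deformation v ε z)) (Q z)
    simp only [Real.norm_eq_abs, Pi.add_apply]
    linarith

theorem energy_map {Q : ℂ → ℝ} {μ : Measure ℂ} [IsProbabilityMeasure μ] (hQm : Measurable Q)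
    {T : ℂ → ℂ} (hT : Measurable T) :
    energy Q (μ.map T) =
      -(∫ p : ℂ × ℂ, Real.log ‖T p.1 - T p.2‖ ∂(μ.prod μ)) + ∫ z, Q (T z) ∂μ := by
  rw [energy, Measure.map_prod_map _ _ hT hT, integral_map (by fun_prop)
    (Measurable.aestronglyMeasurable (by fun_prop)),
    integral_map hT.aemeasurable hQm.aestronglyMeasurable, ← integral_neg]
  simp [Real.log_inv]

theorem hasFiniteEnergy_map {Q : ℂ → ℝ} {μ : Measure ℂ} [IsProbabilityMeasure μ]
    (hμ : HasFiniteEnergy Q μ) (hQm : Measurable Q) {T : ℂ → ℂ} (hT : Measurable T)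
    (hinj : Function.Injective T)
    (hlog : Integrable (fun p : ℂ × ℂ => Real.log ‖T p.1 - T p.2‖) (μ.prod μ))
    (hQ : Integrable (fun z => Q (T z)) μ) : HasFiniteEnergy Q (μ.map T) where
  noAtoms := ⟨fun x => by
    rw [Measure.map_apply hT (measurableSet_singleton x)]
    have := hμ.noAtoms
    exact (subsingleton_singleton.preimage hinj).measure_zero μ⟩
  integrable_log := by
    rw [Measure.map_prod_map _ _ hT hT, integrable_map_measure
      (Measurable.aestronglyMeasurable (by fun_prop)) (by fun_prop)]
    exact hlog
  integrable_potential := by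
    rw [integrable_map_measure hQm.aestronglyMeasurable hT.aemeasurable]
    exact hQ

/-- The deformed measures are competitors for `ε` of both signs, so `ε = 0` is a two-sided local
minimum of a differentiable function. -/
theorem first_variation_eq_zero {Q : ℂ → ℝ} {X : Set ℂ} {μ : Measure ℂ}
    (hμ : IsEquilibriumMeasure Q X μ) (hX : MeasurableSet X) (hQm : Measurable Q)
    {D : Set ℂ} (hD : IsOpen D) (hDX : D ⊆ X) (hQD : ContDiffOn ℝ 1 Q D) {v : ℂ → ℂ} {L : NNReal}
    (hv : LipschitzWith L v) (hvc : HasCompactSupport v) (hvD : tsupport v ⊆ D) :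
    ∫ z, 2 * (wirtinger Q z * v z).re ∂μ =
      ∫ p : ℂ × ℂ, ((v p.1 - v p.2) / (p.1 - p.2)).re ∂(μ.prod μ) := by
  have hprob := hμ.prob
  have hlog := hasDerivAt_integral_log_norm_deformation hμ.finite.integrable_log hv
  obtain ⟨hpot, hint⟩ := hasDerivAt_integral_comp_deformation hQm hμ.finite.integrable_potential
    hD hQD hv.continuous hvc hvD
  have hdm : ∀ ε, Measurable (deformation v ε) := fun ε =>
    (continuous_deformation hv.continuous ε).measurable
  obtain ⟨N, hND, -, r, hr, hrN⟩ := exists_deformation_mem hv.continuous hvc hD hvD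
  obtain ⟨r', hr', hrL⟩ := exists_pos_abs_mul_le_half L
  have hmin : IsLocalMin (fun ε => energy Q (μ.map (deformation v ε))) 0 := by
    filter_upwards [hint, Metric.ball_mem_nhds 0 hr, Metric.ball_mem_nhds 0 hr']
      with ε hε1 hε2 hε3
    have hinj : Function.Injective (deformation v ε) := by
      intro z w hzw
      have h1 := norm_deformation_sub_ge hv (hrL ε hε3) z w
      rw [hzw, sub_self, norm_zero] at h1
      exact sub_eq_zero.1 (norm_le_zero_iff.1 (by linarith))
    rw [deformation_zero, Measure.map_id]
    refine hμ.minimal _ (Measure.isProbabilityMeasure_map (hdm ε).aemeasurable) ?_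
      (hasFiniteEnergy_map hμ.finite hQm (hdm ε) hinj
        (integrable_log_norm_deformation hμ.finite.integrable_log hv (hrL ε hε3)) hε1)
    rw [Measure.map_apply (hdm ε) hX.compl]
    refine measure_mono_null (fun z hz => ?_) hμ.carried
    -- A point of `X` remains in `X`: it is either fixed or lies in the support of `v`, which is
    -- carried into `D ⊆ X`.
    intro hzX
    refine hz ?_
    by_cases hz' : z ∈ tsupport v
    · exact hDX (hND (hrN ε hε2 z hz'))
    · simpa [deformation, image_eq_zero_of_notMem_tsupport hz'] using hzX
  have hderiv := hlog.neg.add hpot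
  have h0 := hmin.hasDerivAt_eq_zero (hderiv.congr_of_eventuallyEq
    (Eventually.of_forall fun ε => energy_map hQm (hdm ε)))
  linarith

/-- The two terms of the numerator are exchanged by swapping the variables, so each contributes the
same integral against the Cauchy transform. Bounded density makes `1/(z - w)` integrable for the
product measure, which justifies the splitting. -/
theorem integral_re_div_sub {μ : Measure ℂ} [IsProbabilityMeasure μ] {c : ENNReal} (hc : c ≠ ⊤)
    (hμ : μ ≤ c • volume) {v : ℂ → ℂ} (hv : Continuous v) (hvc : HasCompactSupport v) :
    ∫ p : ℂ × ℂ, ((v p.1 - v p.2) / (p.1 - p.2)).re ∂(μ.prod μ) =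
      ∫ z, 2 * (cauchyTransform μ z * v z).re ∂μ := by
  obtain ⟨M, hM⟩ := hvc.exists_bound_of_continuous hv
  have hk := integrable_prod_inv_sub hc hμ
  have h1 : Integrable (fun p : ℂ × ℂ => v p.1 * (p.1 - p.2)⁻¹) (μ.prod μ) :=
    hk.bdd_mul (c := M) (by fun_prop) (ae_of_all _ fun p => hM _)
  have h2 : Integrable (fun p : ℂ × ℂ => v p.2 * (p.2 - p.1)⁻¹) (μ.prod μ) := h1.swap
  have e1 : ∫ p : ℂ × ℂ, v p.1 * (p.1 - p.2)⁻¹ ∂(μ.prod μ)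
      = ∫ z, cauchyTransform μ z * v z ∂μ := by
    rw [integral_prod _ h1]
    congr 1 with z
    change ∫ w, v z * (z - w)⁻¹ ∂μ = _
    rw [integral_const_mul, cauchyTransform, mul_comm]
  have e2 : ∫ p : ℂ × ℂ, v p.2 * (p.2 - p.1)⁻¹ ∂(μ.prod μ)
      = ∫ z, cauchyTransform μ z * v z ∂μ := by
    rw [← e1]
    exact integral_prod_swap (μ := μ) (ν := μ) (fun p : ℂ × ℂ => v p.1 * (p.1 - p.2)⁻¹)
  have hC : Integrable (fun z => cauchyTransform μ z * v z) μ := by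
    have := (continuous_cauchyTransform hc hμ).mul hv
    exact this.integrable_of_hasCompactSupport hvc.mul_left
  have e3 : ∀ p : ℂ × ℂ, (v p.1 - v p.2) / (p.1 - p.2)
      = v p.1 * (p.1 - p.2)⁻¹ + v p.2 * (p.2 - p.1)⁻¹ := fun p => by
    rw [← neg_sub p.1 p.2, inv_neg]; ring
  simp only [e3]
  rw [integral_const_mul]
  have h3 : ∫ p : ℂ × ℂ, (v p.1 * (p.1 - p.2)⁻¹ + v p.2 * (p.2 - p.1)⁻¹).re ∂(μ.prod μ)
      = (∫ p : ℂ × ℂ, (v p.1 * (p.1 - p.2)⁻¹ + v p.2 * (p.2 - p.1)⁻¹) ∂(μ.prod μ)).re :=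
    integral_re (h1.add h2)
  have h4 : ∫ z, (cauchyTransform μ z * v z).re ∂μ = (∫ z, cauchyTransform μ z * v z ∂μ).re :=
    integral_re hC
  rw [h3, h4, integral_add h1 h2, e1, e2, add_re]
  ring

/-- On the open set where it is continuously differentiable and inside the carrier, the potential
of an equilibrium measure with bounded density has the Cauchy transform as its Wirtinger
derivative. -/
theorem ae_wirtinger_eq_cauchyTransform {Q : ℂ → ℝ} {X : Set ℂ} {μ : Measure ℂ}
    (hμ : IsEquilibriumMeasure Q X μ) {c : ENNReal} (hc : c ≠ ⊤) (hμc : μ ≤ c • volume)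
    (hX : MeasurableSet X) (hQm : Measurable Q) {D : Set ℂ} (hD : IsOpen D) (hDX : D ⊆ X)
    (hQD : ContDiffOn ℝ 1 Q D) :
    ∀ᵐ z ∂μ, z ∈ D → wirtinger Q z = cauchyTransform μ z := by
  have hprob := hμ.prob
  have hCc := continuous_cauchyTransform hc hμc
  have hwc : ContinuousOn (wirtinger Q) D := by
    have := hQD.continuousOn_fderiv_of_isOpen hD le_rfl
    unfold wirtinger
    fun_prop
  have hre : ∀ v : ℂ → ℂ, ContDiff ℝ 1 v → HasCompactSupport v → tsupport v ⊆ D →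
      ∫ z, ((wirtinger Q z - cauchyTransform μ z) * v z).re ∂μ = 0 ∧
      Integrable (fun z => (wirtinger Q z - cauchyTransform μ z) * v z) μ := by
    intro v hv hvc hvD
    obtain ⟨L, hL⟩ := hv.lipschitzWith_of_hasCompactSupport hvc one_ne_zero
    have h1 := first_variation_eq_zero hμ hX hQm hD hDX hQD hL hvc hvD
    rw [integral_re_div_sub hc hμc hv.continuous hvc, integral_const_mul, integral_const_mul] at h1
    have hi1 : Integrable (fun z => wirtinger Q z * v z) μ := by
      have hts : tsupport (fun z => wirtinger Q z * v z) ⊆ D :=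
        tsupport_mul_subset_right.trans hvD
      exact ((hwc.mul hv.continuous.continuousOn).continuous_of_tsupport_subset hD
        hts).integrable_of_hasCompactSupport hvc.mul_left
    have hi2 : Integrable (fun z => cauchyTransform μ z * v z) μ :=
      (hCc.mul hv.continuous).integrable_of_hasCompactSupport hvc.mul_left
    simp only [sub_mul, sub_re]
    refine ⟨?_, hi1.sub hi2⟩
    have h2 := integral_sub hi1.re hi2.re
    simp only [RCLike.re_to_complex] at h2
    linarith
  have key := hD.ae_eq_zero_of_integral_contDiff_smul_eq_zero (μ := μ)
    (f := fun z => wirtinger Q z - cauchyTransform μ z)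
    ((hwc.sub hCc.continuousOn).locallyIntegrableOn hD.measurableSet) ?_
  · filter_upwards [key] with z hz hzD using sub_eq_zero.1 (hz hzD)
  intro g hg hgc hgD
  have hg1 : ContDiff ℝ 1 (fun z => (g z : ℂ)) :=
    ofRealCLM.contDiff.comp (hg.of_le (by exact_mod_cast le_top))
  have hsupp : Function.support (fun z => (g z : ℂ)) = Function.support g := by
    ext z; simp
  have hts : tsupport (fun z => (g z : ℂ)) = tsupport g := by rw [tsupport, hsupp, tsupport]
  have hg1c : HasCompactSupport (fun z => (g z : ℂ)) := by
    rw [HasCompactSupport, hts]; exact hgc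
  obtain ⟨r1, i1⟩ := hre _ hg1 hg1c (hts ▸ hgD)
  -- The variation controls only real parts; rotating the field by `-i` supplies the imaginary part.
  obtain ⟨r2, -⟩ := hre (fun z => -I * g z) (contDiff_const.mul hg1) hg1c.mul_left
    ((tsupport_mul_subset_right).trans (hts ▸ hgD))
  have e : ∀ z, g z • (wirtinger Q z - cauchyTransform μ z)
      = (wirtinger Q z - cauchyTransform μ z) * g z := fun z => by
    rw [real_smul, mul_comm]
  simp only [e]
  have h1 : ∫ z, ((wirtinger Q z - cauchyTransform μ z) * g z).re ∂μ
      = (∫ z, (wirtinger Q z - cauchyTransform μ z) * g z ∂μ).re := integral_re i1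
  have h2 : ∫ z, ((wirtinger Q z - cauchyTransform μ z) * g z).im ∂μ
      = (∫ z, (wirtinger Q z - cauchyTransform μ z) * g z ∂μ).im := integral_im i1
  have h3 : ∀ z, ((wirtinger Q z - cauchyTransform μ z) * (-I * g z)).re
      = ((wirtinger Q z - cauchyTransform μ z) * g z).im := fun z => by
    rw [mul_left_comm, neg_mul, neg_re, I_mul_re, neg_neg]
  apply Complex.ext
  · rw [← h1, r1, zero_re]
  · simp only [h3] at r2
    rw [← h2, r2, zero_im]

/-! ### Hele-Shaw potentials -/

theorem finite_poles (h : RatFunc ℂ) : (poles h).Finite := by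
  have := Polynomial.finite_setOfPred_isRoot h.denom_ne_zero
  exact this

theorem isOpen_compl_poles (h : RatFunc ℂ) : IsOpen (poles h)ᶜ :=
  (finite_poles h).isClosed.isOpen_compl

theorem eval_eq_div (h : RatFunc ℂ) (z : ℂ) :
    h.eval (RingHom.id ℂ) z = h.num.eval z / h.denom.eval z := by
  simp [RatFunc.eval, Polynomial.eval₂_id]

theorem analyticAt_eval {h : RatFunc ℂ} {z : ℂ} (hz : z ∉ poles h) :
    AnalyticAt ℂ (fun u => h.eval (RingHom.id ℂ) u) z := by
  simp only [eval_eq_div]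
  exact (AnalyticOnNhd.eval_polynomial _ z trivial).div
    (AnalyticOnNhd.eval_polynomial _ z trivial) hz

theorem num_eval_ne_zero_of_mem_poles {h : RatFunc ℂ} {z : ℂ} (hz : z ∈ poles h) :
    h.num.eval z ≠ 0 := by
  intro h0
  obtain ⟨a, b, hab⟩ := h.isCoprime_num_denom
  have := congrArg (Polynomial.eval z) hab
  have hz : h.denom.eval z = 0 := hz
  simp [h0, hz] at this

theorem meromorphicAt_eval_inv (h : RatFunc ℂ) :
    MeromorphicAt (fun z => h.eval (RingHom.id ℂ) z⁻¹) 0 := by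
  have hp : ∀ p : Polynomial ℂ, MeromorphicAt (fun z : ℂ => p.eval z⁻¹) 0 := by
    intro p
    have hi : MeromorphicAt (fun z : ℂ => z⁻¹) 0 := (MeromorphicAt.id 0).inv
    simp only [Polynomial.eval_eq_sum_range]
    refine MeromorphicAt.fun_sum fun n _ => ?_
    exact (MeromorphicAt.const _ _).mul (hi.pow n)
  simp only [eval_eq_div]
  exact (hp _).div (hp _)

variable {t₀ : ℝ} {H : ℂ → ℝ} {h : RatFunc ℂ}

/-- `H` is continuous off the poles and arbitrary at them, a finite set that does not affect
measurability. -/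
theorem IsHarmonicWithRationalDerivative.measurable
    (hH : IsHarmonicWithRationalDerivative H h) : Measurable H := by
  classical
  have h1 : ContinuousOn H (poles h)ᶜ := hH.harmonic.continuousOn
  have h2 : Measurable ((poles h)ᶜ.piecewise H (fun _ => 0)) :=
    h1.measurable_piecewise continuousOn_const (isOpen_compl_poles h).measurableSet
  refine h2.measurable_of_countable_ne ((finite_poles h).countable.mono fun z hz => ?_)
  by_contra hz'
  exact hz (piecewise_eq_of_mem _ _ _ hz')

theorem measurable_potential (hH : IsHarmonicWithRationalDerivative H h) :
    Measurable (potential t₀ H) := by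
  have := hH.measurable
  unfold potential
  fun_prop

theorem contDiffOn_potential (hH : IsHarmonicWithRationalDerivative H h) :
    ContDiffOn ℝ 2 (potential t₀ H) (poles h)ᶜ := by
  have h1 : ContDiffOn ℝ 2 H (poles h)ᶜ := hH.harmonic.contDiffOn
  unfold potential
  exact ((contDiff_norm_sq ℝ).contDiffOn.sub h1).div_const _

theorem analyticAt_potential (hH : IsHarmonicWithRationalDerivative H h) {z : ℂ}
    (hz : z ∉ poles h) : AnalyticAt ℝ (potential t₀ H) z := by
  have h1 : AnalyticAt ℝ H z := HarmonicAt.analyticAt (hH.harmonic z hz)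
  have h2 : AnalyticAt ℝ (fun z : ℂ => ‖z‖ ^ 2) z := by
    have e : (fun z : ℂ => ‖z‖ ^ 2) = fun z => reCLM z * reCLM z + imCLM z * imCLM z := by
      ext z; rw [← Complex.normSq_eq_norm_sq, Complex.normSq_apply]; rfl
    rw [e]
    have a := reCLM.analyticAt z
    have b := imCLM.analyticAt z
    exact (a.mul a).add (b.mul b)
  have e : potential t₀ H = fun z => t₀⁻¹ * (‖z‖ ^ 2 - H z) := by
    ext z; rw [potential, div_eq_inv_mul]
  rw [e]
  exact analyticAt_const.mul (h2.sub h1)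

theorem fderiv_norm_sq_eq_inner (z v : ℂ) :
    fderiv ℝ (fun z : ℂ => ‖z‖ ^ 2) z v = 2 * inner ℝ z v := by
  rw [fderiv_norm_sq_apply, smul_apply, innerSL_apply_apply, two_smul, two_mul]

theorem wirtinger_potential (hH : IsHarmonicWithRationalDerivative H h) {z : ℂ}
    (hz : z ∉ poles h) :
    wirtinger (potential t₀ H) z =
      ((starRingEnd ℂ) z - h.eval (RingHom.id ℂ) z) / t₀ := by
  have h1 : DifferentiableAt ℝ H z := (hH.harmonic z hz).1.differentiableAt two_ne_zero
  have h2 : DifferentiableAt ℝ (fun z : ℂ => ‖z‖ ^ 2) z :=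
    (contDiff_norm_sq ℝ (n := 1)).differentiable one_ne_zero z
  have e : potential t₀ H = t₀⁻¹ • ((fun z : ℂ => ‖z‖ ^ 2) - H) := by
    ext z; simp [potential, div_eq_inv_mul]
  have h3 := hH.deriv_eq z hz
  rw [← h3, wirtinger, wirtinger, e, fderiv_const_smul (h2.sub h1), fderiv_sub h2 h1]
  simp only [smul_apply, sub_apply, fderiv_norm_sq_eq_inner,
    Complex.inner, smul_eq_mul]
  push_cast
  have hc : (starRingEnd ℂ) z = z.re - I * z.im := by
    apply Complex.ext <;> simp
  rw [hc]
  simp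
  ring

theorem laplacian_norm_sq (z : ℂ) : Laplacian.laplacian (fun z : ℂ => ‖z‖ ^ 2) z = 4 := by
  have e : fderiv ℝ (fun z : ℂ => ‖z‖ ^ 2) = fun z => (2 : ℝ) • innerSL ℝ z := by
    ext z v
    rw [fderiv_norm_sq_eq_inner, smul_apply, innerSL_apply_apply, smul_eq_mul]
  rw [InnerProductSpace.laplacian_eq_iteratedFDeriv_complexPlane]
  simp only [iteratedFDeriv_two_apply, e]
  have e2 : fderiv ℝ (fun z : ℂ => (2 : ℝ) • innerSL ℝ z) z = (2 : ℝ) • innerSL ℝ :=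
    ((2 : ℝ) • (innerSL ℝ : ℂ →L[ℝ] ℂ →L[ℝ] ℝ)).fderiv
  rw [e2]
  change (2 : ℝ) * inner ℝ (1 : ℂ) 1 + (2 : ℝ) * inner ℝ I I = 4
  rw [real_inner_self_eq_norm_sq, real_inner_self_eq_norm_sq, norm_one, norm_I]
  norm_num

theorem laplacian_potential (hH : IsHarmonicWithRationalDerivative H h) {z : ℂ}
    (hz : z ∉ poles h) : Laplacian.laplacian (potential t₀ H) z = 4 / t₀ := by
  have h1 := hH.harmonic z hz
  have e : potential t₀ H = t₀⁻¹ • ((fun z : ℂ => ‖z‖ ^ 2) - H) := by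
    ext z; simp [potential, div_eq_inv_mul]
  have h2 : ContDiffAt ℝ 2 (fun z : ℂ => ‖z‖ ^ 2) z := (contDiff_norm_sq ℝ).contDiffAt
  have h3 : Laplacian.laplacian H z = 0 := h1.2.eq_of_nhds
  rw [e, InnerProductSpace.laplacian_smul t₀⁻¹ (f := (fun z : ℂ => ‖z‖ ^ 2) - H) (h2.sub h1.1), h2.laplacian_sub h1.1,
    laplacian_norm_sq, h3, smul_eq_mul, sub_zero, div_eq_inv_mul]

theorem dropletMeasure_le (hH : IsHarmonicWithRationalDerivative H h) (K : Set ℂ) :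
    dropletMeasure (potential t₀ H) K ≤ ENNReal.ofReal (4 / t₀ / 4 / Real.pi) • volume := by
  have hae : (fun z => ENNReal.ofReal
      (Laplacian.laplacian (potential t₀ H) z / 4 / Real.pi)) =ᵐ[volume.restrict K]
      fun _ => ENNReal.ofReal (4 / t₀ / 4 / Real.pi) := by
    have : ∀ᵐ z ∂(volume : Measure ℂ), z ∉ poles h := (finite_poles h).countable.ae_notMem _
    filter_upwards [ae_restrict_of_ae this] with z hz
    rw [laplacian_potential hH hz]
  rw [dropletMeasure, withDensity_congr_ae hae, withDensity_const]
  gcongr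
  exact Measure.restrict_le_self

/-- On a local droplet there are no poles of `∂H`, and `∂H(z) = z̄ - t₀ C(z)`, where `C` is the
Cauchy transform of the equilibrium measure. -/
theorem IsLocalDroplet.eval_eq (ht₀ : 0 < t₀) (hH : IsHarmonicWithRationalDerivative H h)
    {K : Set ℂ} (hK : IsLocalDroplet (potential t₀ H) K) {z : ℂ} (hz : z ∈ K) :
    z ∉ poles h ∧ h.eval (RingHom.id ℂ) z = (starRingEnd ℂ) z -
      t₀ * cauchyTransform (dropletMeasure (potential t₀ H) K) z := by
  obtain ⟨U, hU, hKU, hd⟩ := hK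
  set μ := dropletMeasure (potential t₀ H) K with hμ
  have hprob := hd.equilibrium.prob
  have hc : ENNReal.ofReal (4 / t₀ / 4 / Real.pi) ≠ ⊤ := ENNReal.ofReal_ne_top
  have hμc : μ ≤ ENNReal.ofReal (4 / t₀ / 4 / Real.pi) • volume := dropletMeasure_le hH K
  have hCc := continuous_cauchyTransform hc hμc
  have hae := ae_wirtinger_eq_cauchyTransform hd.equilibrium hc hμc
    isClosed_closure.measurableSet (measurable_potential hH)
    (hU.inter (isOpen_compl_poles h)) (inter_subset_left.trans subset_closure)
    ((contDiffOn_potential hH).of_le (by norm_num) |>.mono inter_subset_right)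
  have hPae : ∀ᵐ z ∂μ, z ∉ poles h := by
    have := hd.equilibrium.finite.noAtoms
    exact (finite_poles h).countable.ae_notMem _
  have hKae : ∀ᵐ z ∂μ, z ∈ K := by
    have := Measure.support_mem_ae (μ := μ)
    rwa [hd.support_eq] at this
  -- Multiplying by the denominator gives a function continuous even at the poles, so vanishing
  -- almost everywhere for `μ` propagates to the whole support.
  set F : ℂ → ℂ := fun z =>
    h.num.eval z - ((starRingEnd ℂ) z - t₀ * cauchyTransform μ z) * h.denom.eval z with hF
  have hFc : Continuous F := by
    have h1 := h.num.continuous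
    have h2 := h.denom.continuous
    have h3 := continuous_conj
    fun_prop
  have ht : (t₀ : ℂ) ≠ 0 := by exact_mod_cast ht₀.ne'
  have hF0ae : ∀ᵐ z ∂μ, F z = 0 := by
    filter_upwards [hae, hPae, hKae] with z h1 h2 h3
    have h4 := h1 ⟨hKU h3, h2⟩
    rw [wirtinger_potential hH h2, eval_eq_div] at h4
    have h5 : h.denom.eval z ≠ 0 := h2
    rw [hμ] at hF
    field_simp at h4
    simp only [hF]
    linear_combination -h4
  have hF0 : F z = 0 := by
    by_contra hne
    have hopen : IsOpen {z | F z ≠ 0} := isOpen_ne_fun hFc continuous_const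
    have hpos : 0 < μ {z | F z ≠ 0} := by
      rw [← hd.support_eq] at hz
      exact (Measure.mem_support_iff_forall z).1 hz _ (hopen.mem_nhds hne)
    exact hpos.ne' (by rwa [ae_iff] at hF0ae)
  -- At a pole the equation reduces to the vanishing of the numerator, contrary to coprimality.
  have hzP : z ∉ poles h := fun hzP => by
    have h0 : h.denom.eval z = 0 := hzP
    refine num_eval_ne_zero_of_mem_poles hzP ?_
    simpa [hF, h0] using hF0
  refine ⟨hzP, ?_⟩
  have h5 : h.denom.eval z ≠ 0 := hzP
  rw [eval_eq_div, div_eq_iff h5]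
  exact sub_eq_zero.1 hF0

/-! ### The unbounded component of the complement of a compact set -/

/-- This set is the image under `exp` of a half-plane. -/
theorem isConnected_setOf_lt_norm {r : ℝ} (hr : 0 < r) : IsConnected {w : ℂ | r < ‖w‖} := by
  have h1 : {w : ℂ | r < ‖w‖} = Complex.exp '' {w : ℂ | Real.log r < w.re} := by
    ext w
    constructor
    · intro hw
      have hw : r < ‖w‖ := hw
      have hw0 : w ≠ 0 := norm_pos_iff.1 (hr.trans hw)
      exact ⟨Complex.log w, by simpa [Complex.log_re] using Real.log_lt_log hr hw, Complex.exp_log hw0⟩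
    · rintro ⟨u, hu, rfl⟩
      have hu : Real.log r < u.re := hu
      simpa [Complex.norm_exp] using (Real.log_lt_iff_lt_exp hr).1 hu
  rw [h1]
  have h2 : Convex ℝ {w : ℂ | Real.log r < w.re} := convex_halfSpace_re_gt _
  refine ⟨?_, h2.isPreconnected.image _ Complex.continuous_exp.continuousOn⟩
  exact Set.Nonempty.image _ ⟨((Real.log r + 1 : ℝ) : ℂ), by simp⟩

/-- The outside of a large disc is connected and misses `K`, and every unbounded component meets it;
so there is exactly one such component. -/
theorem exists_outerDomain_eq {K : Set ℂ} (hK : IsCompact K) :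
    ∃ r : ℝ, 0 < r ∧ {z : ℂ | r < ‖z‖} ⊆ outerDomain K ∧
      ∀ z₀ ∈ outerDomain K, outerDomain K = connectedComponentIn Kᶜ z₀ := by
  obtain ⟨r, hr, hKr⟩ := hK.isBounded.exists_pos_norm_le
  have hsub : {z : ℂ | r < ‖z‖} ⊆ Kᶜ := fun z hz hzK => (hKr z hzK).not_gt hz
  have hcomp : ∀ z : ℂ, r < ‖z‖ → {z : ℂ | r < ‖z‖} ⊆ connectedComponentIn Kᶜ z := fun z hz =>
    (isConnected_setOf_lt_norm hr).isPreconnected.subset_connectedComponentIn hz hsub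
  have hunb : ∀ A : Set ℂ, {z : ℂ | r < ‖z‖} ⊆ A → ¬ Bornology.IsBounded A := by
    intro A hA hb
    obtain ⟨M, hM0, hM⟩ := hb.exists_pos_norm_le
    have : ((r + M : ℝ) : ℂ) ∈ A := hA (by
      simp only [mem_ofPred_eq, norm_real, Real.norm_eq_abs]
      rw [abs_of_pos (by linarith)]; linarith)
    have := hM _ this
    rw [norm_real, Real.norm_eq_abs, abs_of_pos (by linarith)] at this
    linarith
  have hmeet : ∀ z ∈ outerDomain K, ∃ w : ℂ, r < ‖w‖ ∧ w ∈ connectedComponentIn Kᶜ z := by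
    intro z hz
    by_contra! hcon
    exact hz.2 (Metric.isBounded_closedBall (x := (0 : ℂ)) (r := r) |>.subset fun w hw => by
      by_contra hw'
      exact hcon w (by simpa using hw') hw)
  have heq : ∀ z ∈ outerDomain K, ∀ w : ℂ, r < ‖w‖ →
      connectedComponentIn Kᶜ z = connectedComponentIn Kᶜ w := by
    intro z hz w hw
    obtain ⟨u, hu, huz⟩ := hmeet z hz
    rw [connectedComponentIn_eq huz]
    exact connectedComponentIn_eq (hcomp u hu hw)
  have hr1 : r < ‖((r + 1 : ℝ) : ℂ)‖ := by
    rw [norm_real, Real.norm_eq_abs, abs_of_pos (by linarith)]; linarith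
  refine ⟨r, hr, fun z hz => ⟨hsub hz, hunb _ (hcomp z hz)⟩, fun z₀ hz₀ => ?_⟩
  ext z
  constructor
  · intro hz
    rw [heq z₀ hz₀ _ hr1, ← heq z hz _ hr1]
    exact mem_connectedComponentIn hz.1
  · intro hz
    refine ⟨connectedComponentIn_subset _ _ hz, ?_⟩
    rw [← connectedComponentIn_eq hz]
    exact hz₀.2

theorem outerDomain_nonempty {K : Set ℂ} (hK : IsCompact K) : (outerDomain K).Nonempty := by
  obtain ⟨r, hr, hsub, -⟩ := exists_outerDomain_eq hK
  exact (isConnected_setOf_lt_norm hr).nonempty.mono hsub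

theorem isBounded_compl_outerDomain {K : Set ℂ} (hK : IsCompact K) :
    Bornology.IsBounded (outerDomain K)ᶜ := by
  obtain ⟨r, hr, hsub, -⟩ := exists_outerDomain_eq hK
  refine (Metric.isBounded_closedBall (x := (0 : ℂ)) (r := r)).subset fun z hz => ?_
  by_contra h
  exact hz (hsub (by simpa using h))

theorem isOpen_outerDomain {K : Set ℂ} (hK : IsCompact K) : IsOpen (outerDomain K) := by
  obtain ⟨r, hr, hsub, heq⟩ := exists_outerDomain_eq hK
  obtain ⟨z₀, hz₀⟩ := outerDomain_nonempty hK
  rw [heq z₀ hz₀]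
  exact hK.isClosed.isOpen_compl.connectedComponentIn

theorem isConnected_outerDomain {K : Set ℂ} (hK : IsCompact K) : IsConnected (outerDomain K) := by
  obtain ⟨r, hr, hsub, heq⟩ := exists_outerDomain_eq hK
  obtain ⟨z₀, hz₀⟩ := outerDomain_nonempty hK
  rw [heq z₀ hz₀]
  exact isConnected_connectedComponentIn_iff.2 hz₀.1

theorem outerDomain_subset_compl (K : Set ℂ) : outerDomain K ⊆ Kᶜ := fun _ hz => hz.1

theorem frontier_outerDomain_subset {K : Set ℂ} (hK : IsCompact K) :
    frontier (outerDomain K) ⊆ K := by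
  intro z hz
  rw [(isOpen_outerDomain hK).frontier_eq] at hz
  by_contra hzK
  have hopen : IsOpen (connectedComponentIn Kᶜ z) := hK.isClosed.isOpen_compl.connectedComponentIn
  obtain ⟨w, hw, hwΩ⟩ := mem_closure_iff.1 hz.1 _ hopen (mem_connectedComponentIn hzK)
  refine hz.2 ⟨hzK, ?_⟩
  rw [connectedComponentIn_eq hw]
  exact hwΩ.2

/-! ### Inverses of injective holomorphic functions -/

theorem nhds_le_map_nhds_of_injOn {f : ℂ → ℂ} {V : Set ℂ} (hV : IsOpen V)
    (hf : DifferentiableOn ℂ f V) (hinj : InjOn f V) {z : ℂ} (hz : z ∈ V) :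
    𝓝 (f z) ≤ map f (𝓝 z) := by
  refine ((hf.analyticAt (hV.mem_nhds hz)).eventually_constant_or_nhds_le_map_nhds).resolve_left ?_
  intro hconst
  have h1 : ∀ᶠ w in 𝓝[≠] z, f w = f z ∧ w ∈ V ∧ w ≠ z :=
    (hconst.filter_mono nhdsWithin_le_nhds).and
      ((eventually_mem_set.2 (mem_nhdsWithin_of_mem_nhds (hV.mem_nhds hz))).and
        self_mem_nhdsWithin)
  obtain ⟨w, hw, hwV, hwz⟩ := h1.exists
  exact hwz (hinj hwV hz hw)

theorem isOpen_image_of_injOn {f : ℂ → ℂ} {V : Set ℂ} (hV : IsOpen V)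
    (hf : DifferentiableOn ℂ f V) (hinj : InjOn f V) : IsOpen (f '' V) := by
  rw [isOpen_iff_mem_nhds]
  rintro _ ⟨z, hz, rfl⟩
  exact nhds_le_map_nhds_of_injOn hV hf hinj hz (image_mem_map (hV.mem_nhds hz))

/-- The open mapping theorem makes the inverse continuous. Zeros of `f'` are isolated, so the
inverse is differentiable on a punctured neighbourhood of each point, and the removable singularity
theorem fills the point in. It need not be known beforehand that `f'` has no zeros. -/
theorem differentiableOn_invFunOn {f : ℂ → ℂ} {V : Set ℂ} (hV : IsOpen V)
    (hf : DifferentiableOn ℂ f V) (hinj : InjOn f V) :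
    DifferentiableOn ℂ (Function.invFunOn f V) (f '' V) := by
  set g := Function.invFunOn f V
  have hgf : ∀ z ∈ V, g (f z) = z := fun z hz => hinj.leftInvOn_invFunOn hz
  have hgV : ∀ w ∈ f '' V, g w ∈ V := fun w hw => Function.invFunOn_mem hw
  have hfg : ∀ w ∈ f '' V, f (g w) = w := fun w hw => Function.invFunOn_eq hw
  have hopen := isOpen_image_of_injOn hV hf hinj
  have hcont : ∀ z ∈ V, ContinuousAt g (f z) := by
    intro z hz
    rw [ContinuousAt, hgf z hz]
    refine (map_mono (nhds_le_map_nhds_of_injOn hV hf hinj hz)).trans ?_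
    rw [map_map]
    refine (tendsto_id.congr' ?_ : Tendsto (g ∘ f) (𝓝 z) (𝓝 z))
    filter_upwards [hV.mem_nhds hz] with w hw using (hgf w hw).symm
  rintro _ ⟨z, hz, rfl⟩
  refine (analyticAt_of_differentiable_on_punctured_nhds_of_continuousAt ?_
    (hcont z hz)).differentiableAt.differentiableWithinAt
  have hfa : AnalyticAt ℂ f z := hf.analyticAt (hV.mem_nhds hz)
  have hne : ∀ᶠ w in 𝓝[≠] z, deriv f w ≠ 0 := by
    refine hfa.deriv.eventually_eq_zero_or_eventually_ne_zero.resolve_left fun h0 => ?_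
    obtain ⟨r, hr, hball⟩ := Metric.eventually_nhds_iff_ball.1 (h0.and (hV.mem_nhds hz))
    have hconst : ∀ w ∈ Metric.ball z r, f w = f z := fun w hw =>
      (convex_ball z r).is_const_of_fderivWithin_eq_zero (𝕜 := ℂ) (f := f)
        (fun u hu => (hf.differentiableAt (hV.mem_nhds (hball u hu).2)).differentiableWithinAt)
        (fun u hu => by
          rw [fderivWithin_of_isOpen Metric.isOpen_ball hu]
          ext
          simpa using (hball u hu).1) hw (Metric.mem_ball_self hr)
    have h1 : ∀ᶠ w in 𝓝[≠] z, w ∈ Metric.ball z r ∧ w ≠ z :=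
      (eventually_mem_set.2 (mem_nhdsWithin_of_mem_nhds (Metric.ball_mem_nhds z hr))).and
        self_mem_nhdsWithin
    obtain ⟨w, hw, hwz⟩ := h1.exists
    exact hwz (hinj (hball w hw).2 hz (hconst w hw))
  have hgne : Tendsto g (𝓝[≠] (f z)) (𝓝[≠] z) := by
    refine tendsto_nhdsWithin_iff.2 ⟨?_, ?_⟩
    · have := (hcont z hz).tendsto
      rw [hgf z hz] at this
      exact this.mono_left nhdsWithin_le_nhds
    · filter_upwards [self_mem_nhdsWithin,
        mem_nhdsWithin_of_mem_nhds (hopen.mem_nhds (mem_image_of_mem f hz))] with w hw hwV hgw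
      exact hw (by rw [mem_singleton_iff, ← hfg w hwV, mem_singleton_iff.1 hgw])
  filter_upwards [hgne.eventually hne,
    mem_nhdsWithin_of_mem_nhds (hopen.mem_nhds (mem_image_of_mem f hz))] with w hw hwV
  have hd : HasDerivAt f (deriv f (g w)) (g w) :=
    (hf.differentiableAt (hV.mem_nhds (hgV w hwV))).hasDerivAt
  have hc : ContinuousAt g w := by
    have := hcont (g w) (hgV w hwV)
    rwa [hfg w hwV] at this
  exact (hd.of_local_left_inverse hc hw
    (by filter_upwards [hopen.mem_nhds hwV] with u hu using hfg u hu)).differentiableAt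

/-- The disc is homeomorphic to the plane, where the complement of a countable set is connected. -/
theorem isConnected_ball_diff_finite {r : ℝ} (hr : 0 < r) {F : Set ℂ} (hF : F.Finite) :
    IsConnected (Metric.ball (0 : ℂ) r \ F) := by
  let e := OpenPartialHomeomorph.univBall (0 : ℂ) r
  have hsrc : e.source = univ := OpenPartialHomeomorph.univBall_source _ _
  have htgt : e.target = Metric.ball 0 r := OpenPartialHomeomorph.univBall_target _ hr
  have hinj : Function.Injective e := by
    rw [← injOn_univ, ← hsrc]; exact e.injOn
  have h1 : IsConnected (e ⁻¹' F)ᶜ :=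
    (hF.preimage hinj.injOn).countable.isConnected_compl_of_one_lt_rank (by simp)
  have h2 : Metric.ball (0 : ℂ) r \ F = e '' (e ⁻¹' F)ᶜ := by
    ext w
    constructor
    · rintro ⟨hw, hwF⟩
      rw [← htgt] at hw
      exact ⟨e.symm w, by simpa [e.right_inv hw] using hwF, e.right_inv hw⟩
    · rintro ⟨u, hu, rfl⟩
      exact ⟨htgt ▸ e.map_source (hsrc ▸ mem_univ u), hu⟩
  rw [h2]
  exact h1.image _ (OpenPartialHomeomorph.continuous_univBall _ _).continuousOn

/-! ### The exterior chart -/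

/-- `φ` is a holomorphic coordinate with values in `{|w| > 1/ρ}` on the neighbourhood `V₀` of the
closure of the exterior domain `Ω`, and `ψ(ζ) = φ⁻¹(1/ζ)` on the punctured disc of radius `ρ > 1`. -/
structure ExteriorChart (Ω : Set ℂ) (φ ψ : ℂ → ℂ) (ρ : ℝ) (V₀ : Set ℂ) : Prop where
  one_lt : 1 < ρ
  isOpen : IsOpen V₀
  holomorphic : DifferentiableOn ℂ φ V₀
  inv_holomorphic : DifferentiableOn ℂ ψ (Metric.ball 0 ρ \ {0})
  closure_subset : closure Ω ⊆ V₀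
  lt_norm : ∀ z ∈ V₀, ρ⁻¹ < ‖φ z‖
  mem_iff : ∀ z ∈ V₀, z ∈ Ω ↔ 1 < ‖φ z‖
  frontier_iff : ∀ z ∈ V₀, z ∈ frontier Ω ↔ ‖φ z‖ = 1
  inv_mem : ∀ ζ ∈ Metric.ball (0 : ℂ) ρ \ {0}, ψ ζ ∈ V₀
  right_inv : ∀ ζ ∈ Metric.ball (0 : ℂ) ρ \ {0}, φ (ψ ζ) = ζ⁻¹
  left_inv : ∀ z ∈ V₀, ψ (φ z)⁻¹ = z
  tendsto_inv : ∃ c : ℝ, 0 < c ∧ Tendsto (fun ζ => ζ * ψ ζ) (𝓝[≠] 0) (𝓝 (c : ℂ))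
  tendsto_infinity : Tendsto (fun z => (φ z)⁻¹) (Bornology.cobounded ℂ) (𝓝 0)

variable {Ω V V₀ : Set ℂ} {φ ψ : ℂ → ℂ} {ρ : ℝ}

theorem IsExteriorConformalMap.mem_iff (hφ : IsExteriorConformalMap Ω V φ) {z : ℂ} (hz : z ∈ V) :
    z ∈ Ω ↔ 1 < ‖φ z‖ := by
  constructor
  · exact fun h => hφ.bijOn.mapsTo h
  · intro h
    obtain ⟨w, hw, hwz⟩ := hφ.bijOn.surjOn (show φ z ∈ {w : ℂ | 1 < ‖w‖} from h)
    exact hφ.injOn (hφ.closure_subset (subset_closure hw)) hz hwz ▸ hw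

theorem IsExteriorConformalMap.tendsto_norm (hφ : IsExteriorConformalMap Ω V φ) :
    Tendsto (fun z => ‖φ z‖) (Bornology.cobounded ℂ) atTop := by
  obtain ⟨c, hc, h⟩ := hφ.normalised
  have h1 : Tendsto (fun z => ‖φ z / z‖ * ‖z‖) (Bornology.cobounded ℂ) atTop :=
    h.norm.pos_mul_atTop (by simpa using hc.ne') tendsto_norm_cobounded_atTop
  refine h1.congr' ?_
  filter_upwards [tendsto_norm_cobounded_atTop.eventually (eventually_gt_atTop 0)] with z hz
  rw [norm_div, div_mul_cancel₀ _ hz.ne']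

theorem IsExteriorConformalMap.norm_eq_one (hφ : IsExteriorConformalMap Ω V φ) (hΩ : IsOpen Ω)
    {z : ℂ} (hz : z ∈ frontier Ω) : ‖φ z‖ = 1 := by
  have hzc : z ∈ closure Ω := frontier_subset_closure hz
  have hzV := hφ.closure_subset hzc
  have hzΩ : z ∉ Ω := by rw [hΩ.frontier_eq] at hz; exact hz.2
  refine le_antisymm (not_lt.1 fun h => hzΩ ((hφ.mem_iff hzV).2 h)) ?_
  have hcont : ContinuousWithinAt (fun z => ‖φ z‖) Ω z :=
    ((hφ.holomorphic.differentiableAt (hφ.isOpen.mem_nhds hzV)).continuousAt.norm).continuousWithinAt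
  have hmem := hcont.mem_closure hzc (t := Ici 1) fun w hw =>
    ((hφ.mem_iff (hφ.closure_subset (subset_closure hw))).1 hw).le
  rwa [isClosed_Ici.closure_eq] at hmem

/-- Approach `w` radially from outside. Since `φ → ∞` at infinity, the preimages stay in a bounded
part of the closure of `Ω`, whose image is compact. -/
theorem IsExteriorConformalMap.mem_image_closure (hφ : IsExteriorConformalMap Ω V φ) {w : ℂ}
    (hw : ‖w‖ = 1) : w ∈ φ '' closure Ω := by
  obtain ⟨M, -, hM⟩ := (Filter.hasBasis_cobounded_norm (E := ℂ)).eventually_iff.1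
    (hφ.tendsto_norm.eventually (eventually_gt_atTop 2))
  have hcomp : IsCompact (closure Ω ∩ Metric.closedBall 0 M) :=
    (isCompact_closedBall 0 M).inter_left isClosed_closure
  have hcont : ContinuousOn φ (closure Ω ∩ Metric.closedBall 0 M) :=
    hφ.holomorphic.continuousOn.mono (inter_subset_left.trans hφ.closure_subset)
  have hclosed := (hcomp.image_of_continuousOn hcont).isClosed
  have hlim : Tendsto (fun t : ℝ => (t : ℂ) * w) (𝓝[>] 1) (𝓝 w) := by
    have : Tendsto (fun t : ℝ => (t : ℂ) * w) (𝓝 1) (𝓝 (((1 : ℝ) : ℂ) * w)) :=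
      Continuous.tendsto (by fun_prop) 1
    rw [ofReal_one, one_mul] at this
    exact this.mono_left nhdsWithin_le_nhds
  have hmem := hclosed.mem_of_tendsto hlim ?_
  · exact image_mono inter_subset_left hmem
  filter_upwards [Ioo_mem_nhdsGT (show (1 : ℝ) < 2 by norm_num)] with t ht
  have hnorm : ‖(t : ℂ) * w‖ = t := by
    rw [norm_mul, hw, mul_one, norm_real, Real.norm_of_nonneg (by linarith [ht.1])]
  obtain ⟨z, hz, hzt⟩ := hφ.bijOn.surjOn (show (t : ℂ) * w ∈ {w : ℂ | 1 < ‖w‖} by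
    rw [mem_ofPred_eq, hnorm]; exact ht.1)
  refine ⟨z, ⟨subset_closure hz, ?_⟩, hzt⟩
  rw [mem_closedBall_zero_iff]
  by_contra! hzM
  have := hM (show z ∈ {x : ℂ | M ≤ ‖x‖} from hzM.le)
  rw [hzt, hnorm] at this
  linarith [ht.2]

theorem IsExteriorConformalMap.exists_lt_norm_subset (hφ : IsExteriorConformalMap Ω V φ) :
    ∃ ρ : ℝ, 1 < ρ ∧ ∀ w : ℂ, ρ⁻¹ < ‖w‖ → w ∈ φ '' V := by
  have hopen : IsOpen (φ '' V) := isOpen_image_of_injOn hφ.isOpen hφ.holomorphic hφ.injOn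
  have hsub : Metric.sphere (0 : ℂ) 1 ⊆ φ '' V := fun w hw =>
    image_mono hφ.closure_subset (hφ.mem_image_closure (by simpa using hw))
  obtain ⟨δ, hδ, hsubδ⟩ := (isCompact_sphere (0 : ℂ) 1).exists_cthickening_subset_open hopen hsub
  -- If `|w| ≤ 1`, its distance to `w/|w|` is `1 - |w|`, which is at most `δ` as soon as `|w| > 1/(1
  -- + δ)`.
  refine ⟨1 + δ, by linarith, fun w hw => ?_⟩
  rcases lt_or_ge 1 ‖w‖ with h1 | h1
  · obtain ⟨z, hz, hzw⟩ := hφ.bijOn.surjOn (show w ∈ {w : ℂ | 1 < ‖w‖} from h1)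
    exact ⟨z, hφ.closure_subset (subset_closure hz), hzw⟩
  · have hw0 : 0 < ‖w‖ := lt_trans (by positivity) hw
    have hw0' : (‖w‖ : ℂ) ≠ 0 := by exact_mod_cast hw0.ne'
    refine hsubδ (Metric.mem_cthickening_of_dist_le w (w / ‖w‖) _ _ ?_ ?_)
    · simp [hw0.ne']
    · have h2 : w - w / ‖w‖ = ((1 - ‖w‖⁻¹ : ℝ) : ℂ) * w := by
        push_cast; field_simp
      have h3 : 1 ≤ ‖w‖⁻¹ := (one_le_inv₀ hw0).2 h1
      have h4 : ‖w‖⁻¹ < 1 + δ := (inv_lt_comm₀ (by linarith) hw0).1 hw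
      rw [dist_eq_norm, h2, norm_mul, norm_real, Real.norm_eq_abs, abs_of_nonpos (by linarith)]
      nlinarith

theorem IsExteriorConformalMap.exists_chart (hφ : IsExteriorConformalMap Ω V φ) (hΩ : IsOpen Ω) :
    ∃ (ψ : ℂ → ℂ) (ρ : ℝ) (V₀ : Set ℂ), V₀ ⊆ V ∧ ExteriorChart Ω φ ψ ρ V₀ := by
  obtain ⟨ρ, hρ, hρV⟩ := hφ.exists_lt_norm_subset
  have hρ0 : 0 < ρ := by linarith
  set g := Function.invFunOn φ V
  have hgf : ∀ z ∈ V, g (φ z) = z := fun z hz => hφ.injOn.leftInvOn_invFunOn hz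
  have hgV : ∀ w ∈ φ '' V, g w ∈ V := fun w hw => Function.invFunOn_mem hw
  have hfg : ∀ w ∈ φ '' V, φ (g w) = w := fun w hw => Function.invFunOn_eq hw
  have hζ : ∀ ζ ∈ Metric.ball (0 : ℂ) ρ \ {0}, ρ⁻¹ < ‖ζ⁻¹‖ := fun ζ hζ => by
    have h0 : 0 < ‖ζ‖ := norm_pos_iff.2 hζ.2
    rw [norm_inv]
    exact (inv_lt_inv₀ hρ0 h0).2 (by simpa using hζ.1)
  have hnormed := hφ.tendsto_norm
  have hright : ∀ ζ ∈ Metric.ball (0 : ℂ) ρ \ {0}, φ (g ζ⁻¹) = ζ⁻¹ := fun ζ h =>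
    hfg _ (hρV _ (hζ ζ h))
  have hpunct : Metric.ball (0 : ℂ) ρ \ {0} ∈ 𝓝[≠] (0 : ℂ) :=
    inter_mem (mem_nhdsWithin_of_mem_nhds (Metric.ball_mem_nhds 0 hρ0)) self_mem_nhdsWithin
  -- For small `ζ` the preimage of `1/ζ` lies in `Ω`; it cannot stay bounded, because `φ` is bounded
  -- on bounded parts of the closure of `Ω`.
  have hinf : Tendsto (fun ζ => g ζ⁻¹) (𝓝[≠] 0) (Bornology.cobounded ℂ) := by
    rw [← tendsto_norm_atTop_iff_cobounded, tendsto_atTop]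
    intro M
    have hcomp : IsCompact (closure Ω ∩ Metric.closedBall 0 M) :=
      (isCompact_closedBall 0 M).inter_left isClosed_closure
    obtain ⟨B, hB⟩ := hcomp.exists_bound_of_continuousOn
      (hφ.holomorphic.continuousOn.mono (inter_subset_left.trans hφ.closure_subset))
    filter_upwards [hpunct, (tendsto_norm_atTop_iff_cobounded.2
      (tendsto_inv₀_nhdsNE_zero (α := ℂ))).eventually (eventually_gt_atTop (max 1 B))]
      with ζ hζ1 hζ2
    by_contra! hM
    have hmem : g ζ⁻¹ ∈ Ω := by
      rw [hφ.mem_iff (hgV _ (hρV _ (hζ ζ hζ1))), hright ζ hζ1]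
      exact (le_max_left _ _).trans_lt hζ2
    have := hB _ ⟨subset_closure hmem, by simpa using hM.le⟩
    rw [hright ζ hζ1] at this
    exact absurd ((le_max_right _ _).trans_lt hζ2) this.not_gt
  refine ⟨fun ζ => g ζ⁻¹, ρ, V ∩ {z | ρ⁻¹ < ‖φ z‖}, inter_subset_left, ?_⟩
  have hcl : closure Ω ⊆ {z | 1 ≤ ‖φ z‖} := by
    intro z hz
    by_cases hzΩ : z ∈ Ω
    · exact ((hφ.mem_iff (hφ.closure_subset hz)).1 hzΩ).le
    · exact (hφ.norm_eq_one hΩ (by rw [hΩ.frontier_eq]; exact ⟨hz, hzΩ⟩)).ge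
  constructor
  · exact hρ
  · exact hφ.holomorphic.continuousOn.norm.isOpen_inter_preimage hφ.isOpen isOpen_Ioi
  · exact hφ.holomorphic.mono inter_subset_left
  · exact (differentiableOn_invFunOn hφ.isOpen hφ.holomorphic hφ.injOn).comp
      (differentiableOn_inv.mono fun z hz => hz.2) fun ζ h => hρV _ (hζ ζ h)
  · exact fun z hz => ⟨hφ.closure_subset hz, (inv_lt_one_of_one_lt₀ hρ).trans_le (hcl hz)⟩
  · exact fun z hz => hz.2
  · exact fun z hz => hφ.mem_iff hz.1
  · intro z hz
    refine ⟨fun h => hφ.norm_eq_one hΩ h, fun h => ?_⟩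
    obtain ⟨u, hu, huz⟩ := hφ.mem_image_closure h
    rw [hΩ.frontier_eq]
    have := hφ.injOn (hφ.closure_subset hu) hz.1 huz
    subst this
    exact ⟨hu, fun h' => ((hφ.mem_iff hz.1).1 h').ne' h⟩
  · intro ζ h
    refine ⟨hgV _ (hρV _ (hζ ζ h)), ?_⟩
    rw [mem_ofPred_eq, hright ζ h]
    exact hζ ζ h
  · exact hright
  · intro z hz
    simp only [inv_inv]
    exact hgf z hz.1
  · obtain ⟨c, hc, hlim⟩ := hφ.normalised
    refine ⟨c⁻¹, by positivity, ?_⟩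
    have h1 := (hlim.comp hinf).inv₀ (by exact_mod_cast hc.ne')
    rw [ofReal_inv]
    refine h1.congr' ?_
    filter_upwards [hpunct] with ζ h
    rw [Function.comp_apply, hright ζ h, inv_div, div_inv_eq_mul, mul_comm]
  · exact tendsto_inv₀_cobounded.comp (tendsto_norm_atTop_iff_cobounded.1 hnormed)

namespace ExteriorChart

theorem pos (hc : ExteriorChart Ω φ ψ ρ V₀) : 0 < ρ := zero_lt_one.trans hc.one_lt

/-- Shrinking serves twice: to keep poles away from the boundary curve, and to make the continuation
bounded. -/
theorem restrict (hc : ExteriorChart Ω φ ψ ρ V₀) {r : ℝ} (hr : 1 < r) (hrρ : r ≤ ρ) :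
    ExteriorChart Ω φ ψ r (V₀ ∩ {z | r⁻¹ < ‖φ z‖}) := by
  have hsub : Metric.ball (0 : ℂ) r \ {0} ⊆ Metric.ball (0 : ℂ) ρ \ {0} :=
    sdiff_subset_sdiff_left (Metric.ball_subset_ball hrρ)
  constructor
  · exact hr
  · exact hc.holomorphic.continuousOn.norm.isOpen_inter_preimage hc.isOpen isOpen_Ioi
  · exact hc.holomorphic.mono inter_subset_left
  · exact hc.inv_holomorphic.mono hsub
  · intro z hz
    have hzV := hc.closure_subset hz
    refine ⟨hzV, (inv_lt_one_of_one_lt₀ hr).trans_le ?_⟩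
    by_cases hzΩ : z ∈ interior Ω
    · exact ((hc.mem_iff z hzV).1 (interior_subset hzΩ)).le
    · exact ((hc.frontier_iff z hzV).1 ⟨hz, hzΩ⟩).ge
  · exact fun z hz => hz.2
  · exact fun z hz => hc.mem_iff z hz.1
  · exact fun z hz => hc.frontier_iff z hz.1
  · intro ζ hζ
    refine ⟨hc.inv_mem ζ (hsub hζ), ?_⟩
    rw [mem_ofPred_eq, hc.right_inv ζ (hsub hζ), norm_inv]
    exact (inv_lt_inv₀ (by linarith) (norm_pos_iff.2 hζ.2)).2 (by simpa using hζ.1)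
  · exact fun ζ hζ => hc.right_inv ζ (hsub hζ)
  · exact fun z hz => hc.left_inv z hz.1
  · exact hc.tendsto_inv
  · exact hc.tendsto_infinity

theorem ne_zero (hc : ExteriorChart Ω φ ψ ρ V₀) {z : ℂ} (hz : z ∈ V₀) : φ z ≠ 0 :=
  norm_pos_iff.1 ((inv_pos.2 hc.pos).trans (hc.lt_norm z hz))

theorem inv_mem_ball (hc : ExteriorChart Ω φ ψ ρ V₀) {z : ℂ} (hz : z ∈ V₀) :
    (φ z)⁻¹ ∈ Metric.ball (0 : ℂ) ρ \ {0} := by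
  refine ⟨?_, inv_ne_zero (hc.ne_zero hz)⟩
  rw [mem_ball_zero_iff, norm_inv]
  exact (inv_lt_comm₀ hc.pos (norm_pos_iff.2 (hc.ne_zero hz))).1 (hc.lt_norm z hz)

theorem isOpen_punctured (ρ : ℝ) : IsOpen (Metric.ball (0 : ℂ) ρ \ {0}) :=
  Metric.isOpen_ball.sdiff isClosed_singleton

theorem punctured_mem_nhdsNE (hc : ExteriorChart Ω φ ψ ρ V₀) :
    Metric.ball (0 : ℂ) ρ \ {0} ∈ 𝓝[≠] (0 : ℂ) :=
  inter_mem (mem_nhdsWithin_of_mem_nhds (Metric.ball_mem_nhds 0 hc.pos)) self_mem_nhdsWithin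

theorem tendsto_cobounded (hc : ExteriorChart Ω φ ψ ρ V₀) :
    Tendsto ψ (𝓝[≠] 0) (Bornology.cobounded ℂ) := by
  obtain ⟨c, hc0, hlim⟩ := hc.tendsto_inv
  rw [← tendsto_norm_atTop_iff_cobounded]
  have h1 : Tendsto (fun ζ => ‖ζ * ψ ζ‖ * ‖ζ⁻¹‖) (𝓝[≠] 0) atTop :=
    hlim.norm.pos_mul_atTop (by simpa using hc0.ne')
      (tendsto_norm_atTop_iff_cobounded.2 tendsto_inv₀_nhdsNE_zero)
  refine h1.congr' ?_
  filter_upwards [self_mem_nhdsWithin] with ζ hζ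
  rw [← norm_mul, mul_right_comm, mul_inv_cancel₀ hζ, one_mul]

theorem inv_mem_domain (hc : ExteriorChart Ω φ ψ ρ V₀) {ζ : ℂ} (h0 : ζ ≠ 0) (h1 : ‖ζ‖ < 1) :
    ψ ζ ∈ Ω := by
  have hζ : ζ ∈ Metric.ball (0 : ℂ) ρ \ {0} := ⟨by simpa using h1.trans hc.one_lt, h0⟩
  rw [hc.mem_iff _ (hc.inv_mem ζ hζ), hc.right_inv ζ hζ, norm_inv]
  exact (one_lt_inv₀ (norm_pos_iff.2 h0)).2 h1

theorem inv_mem_frontier (hc : ExteriorChart Ω φ ψ ρ V₀) {ζ : ℂ} (h1 : ‖ζ‖ = 1) :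
    ψ ζ ∈ frontier Ω := by
  have hζ : ζ ∈ Metric.ball (0 : ℂ) ρ \ {0} :=
    ⟨by simpa [h1] using hc.one_lt, norm_pos_iff.1 (by rw [h1]; exact one_pos)⟩
  rw [hc.frontier_iff _ (hc.inv_mem ζ hζ), hc.right_inv ζ hζ, norm_inv, h1, inv_one]

/-- In the coordinate `ζ = 1/φ` the set is a disc with finitely many points removed: the origin,
standing for `∞`, and the images of the points of `P`. -/
theorem isConnected_diff (hc : ExteriorChart Ω φ ψ ρ V₀) {P : Set ℂ} (hP : P.Finite) :
    IsConnected (V₀ \ P) := by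
  set F : Set ℂ := insert 0 ((fun z => (φ z)⁻¹) '' (V₀ ∩ P))
  have hF : F.Finite := ((hP.subset inter_subset_right).image _).insert 0
  have h2 : V₀ \ P = ψ '' (Metric.ball (0 : ℂ) ρ \ F) := by
    ext z
    constructor
    · rintro ⟨hz, hzP⟩
      refine ⟨(φ z)⁻¹, ⟨(hc.inv_mem_ball hz).1, ?_⟩, hc.left_inv z hz⟩
      rintro (h0 | ⟨p, hp, hpz⟩)
      · exact (hc.inv_mem_ball hz).2 h0
      · refine hzP ?_
        rw [← hc.left_inv z hz, ← hpz, hc.left_inv p hp.1]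
        exact hp.2
    · rintro ⟨ζ, ⟨hζ, hζF⟩, rfl⟩
      have h0 : ζ ≠ 0 := fun h => hζF (Or.inl h)
      have hV := hc.inv_mem ζ ⟨hζ, h0⟩
      refine ⟨hV, fun hP => hζF (Or.inr ⟨ψ ζ, ⟨hV, hP⟩, ?_⟩)⟩
      simp only [hc.right_inv ζ ⟨hζ, h0⟩, inv_inv]
  rw [h2]
  exact (isConnected_ball_diff_finite hc.pos hF).image _
    (hc.inv_holomorphic.continuousOn.mono fun ζ hζ => ⟨hζ.1, fun h => hζ.2 (Or.inl h)⟩)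

/-- Pushing the coordinate `1/φ(z)` of a boundary point radially outward gives points arbitrarily
near `z` with `|φ| < 1`, hence outside the closure of `Ω`. -/
theorem interior_closure (hc : ExteriorChart Ω φ ψ ρ V₀) (hΩ : IsOpen Ω) :
    interior (closure Ω) = Ω := by
  refine subset_antisymm (fun z hz => ?_) (interior_maximal subset_closure hΩ)
  by_contra hzΩ
  have hzf : z ∈ frontier Ω := by
    rw [hΩ.frontier_eq]; exact ⟨interior_subset hz, hzΩ⟩
  have hzV := hc.closure_subset (interior_subset hz)
  have hn := (hc.frontier_iff z hzV).1 hzf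
  have hζ := hc.inv_mem_ball hzV
  have hcont : ContinuousAt ψ (φ z)⁻¹ :=
    (hc.inv_holomorphic.differentiableAt ((isOpen_punctured ρ).mem_nhds hζ)).continuousAt
  have hlim : Tendsto (fun t : ℝ => (t : ℂ) * (φ z)⁻¹) (𝓝[>] 1) (𝓝 (φ z)⁻¹) := by
    have : Tendsto (fun t : ℝ => (t : ℂ) * (φ z)⁻¹) (𝓝 1) (𝓝 (((1 : ℝ) : ℂ) * (φ z)⁻¹)) :=
      Continuous.tendsto (by fun_prop) 1
    rw [ofReal_one, one_mul] at this
    exact this.mono_left nhdsWithin_le_nhds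
  have h1 := (hcont.tendsto.comp hlim)
  rw [hc.left_inv z hzV] at h1
  have h2 := h1.eventually (mem_interior_iff_mem_nhds.1 hz)
  obtain ⟨t, ht, ht1⟩ := (h2.and (Ioo_mem_nhdsGT hc.one_lt)).exists
  have hnorm : ‖(t : ℂ) * (φ z)⁻¹‖ = t := by
    rw [norm_mul, norm_inv, hn, inv_one, mul_one, norm_real,
      Real.norm_of_nonneg (by linarith [ht1.1])]
  have hmem : (t : ℂ) * (φ z)⁻¹ ∈ Metric.ball (0 : ℂ) ρ \ {0} := by
    refine ⟨by rw [mem_ball_zero_iff, hnorm]; exact ht1.2, norm_pos_iff.1 ?_⟩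
    rw [hnorm]; linarith [ht1.1]
  have h3 : ψ ((t : ℂ) * (φ z)⁻¹) ∈ closure Ω := ht
  have h4 : ‖φ (ψ ((t : ℂ) * (φ z)⁻¹))‖ < 1 := by
    rw [hc.right_inv _ hmem, norm_inv, hnorm]
    exact inv_lt_one_of_one_lt₀ ht1.1
  have hV := hc.inv_mem _ hmem
  rw [closure_eq_self_union_frontier] at h3
  rcases h3 with h3 | h3
  · exact h4.not_gt ((hc.mem_iff _ hV).1 h3)
  · exact h4.ne ((hc.frontier_iff _ hV).1 h3)

end ExteriorChart

/-! ### The Schwarz function -/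

/-- A holomorphic function on an annulus that vanishes on the outer boundary circle is zero. -/
theorem eq_zero_of_annulus {g : ℂ → ℂ} {s : ℝ} (hs : 0 < s)
    (hg : DifferentiableOn ℂ g {ζ | s < ‖ζ‖ ∧ ‖ζ‖ < 1})
    (hgc : ContinuousOn g {ζ | s ≤ ‖ζ‖ ∧ ‖ζ‖ ≤ 1}) (h0 : ∀ ζ : ℂ, ‖ζ‖ = 1 → g ζ = 0) {ζ : ℂ}
    (hζ : s < ‖ζ‖) (hζ1 : ‖ζ‖ < 1) : g ζ = 0 := by
  set A : Set ℂ := {ζ | s < ‖ζ‖ ∧ ‖ζ‖ < 1} with hA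
  set A' : Set ℂ := {ζ | s ≤ ‖ζ‖ ∧ ‖ζ‖ ≤ 1} with hA'
  have hAopen : IsOpen A :=
    (isOpen_lt continuous_const continuous_norm).inter (isOpen_lt continuous_norm continuous_const)
  have hA'closed : IsClosed A' :=
    (isClosed_le continuous_const continuous_norm).inter
      (isClosed_le continuous_norm continuous_const)
  have hA'b : Bornology.IsBounded A' :=
    (Metric.isBounded_closedBall (x := (0 : ℂ)) (r := 1)).subset fun z hz => by simpa using hz.2
  have hAA' : A ⊆ A' := fun z hz => ⟨hz.1.le, hz.2.le⟩
  have hcl : closure A ⊆ A' := closure_minimal hAA' hA'closed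
  obtain ⟨M, hM⟩ := (Metric.isCompact_of_isClosed_isBounded hA'closed
    hA'b).exists_bound_of_continuousOn hgc
  have hζA : ζ ∈ A := ⟨hζ, hζ1⟩
  have hM0 : 0 ≤ M := (norm_nonneg _).trans (hM ζ (hAA' hζA))
  -- The maximum principle for `g(z) zⁿ`: only the inner circle contributes, and since `s < |ζ|` its
  -- share dies as `n → ∞`.
  have key : ∀ n : ℕ, ‖g ζ‖ * ‖ζ‖ ^ n ≤ M * s ^ n := by
    intro n
    have hd : DiffContOnCl ℂ (fun z => g z * z ^ n) A :=
      ⟨hg.mul (by fun_prop), (hgc.mono hcl).mul (by fun_prop)⟩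
    have := norm_le_of_forall_mem_frontier_norm_le (hA'b.subset hAA') hd
      (C := M * s ^ n) (fun z hz => ?_) (subset_closure hζA)
    · simpa using this
    rw [hAopen.frontier_eq] at hz
    have hz' := hcl hz.1
    rcases hz'.2.lt_or_eq with h1 | h1
    · have h2 : ‖z‖ = s := by
        refine le_antisymm (not_lt.1 fun h => hz.2 ⟨h, h1⟩) hz'.1
      rw [norm_mul, norm_pow, h2]
      gcongr
      exact hM z hz'
    · rw [h0 z h1, zero_mul, norm_zero]
      positivity
  have hζ0 : 0 < ‖ζ‖ := hs.trans hζ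
  have hlim : Tendsto (fun n : ℕ => M * (s / ‖ζ‖) ^ n) atTop (𝓝 (M * 0)) :=
    (tendsto_pow_atTop_nhds_zero_of_lt_one (by positivity)
      ((div_lt_one hζ0).2 hζ)).const_mul M
  have hle : ‖g ζ‖ ≤ M * 0 := ge_of_tendsto' hlim fun n => by
    rw [div_pow, ← mul_div_assoc, le_div_iff₀ (by positivity)]
    exact key n
  exact norm_le_zero_iff.1 (by simpa using hle)

theorem toMeromorphicNFOn_apply_of_analyticAt {F : ℂ → ℂ} {U : Set ℂ} (hF : MeromorphicOn F U)
    {z : ℂ} (hz : z ∈ U) (hFz : AnalyticAt ℂ F z) : toMeromorphicNFOn F U z = F z := by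
  rw [toMeromorphicNFOn_eq_toMeromorphicNFAt hF hz,
    toMeromorphicNFAt_eq_self.2 hFz.meromorphicNFAt]

namespace ExteriorChart

variable {Ω V₀ P : Set ℂ} {φ ψ : ℂ → ℂ} {ρ : ℝ}

/-- Finitely many points, none on the curve `|φ| = 1`, so a thin annulus `r⁻¹ < |φ| < r` contains
none of them. -/
theorem exists_radius_avoiding (hc : ExteriorChart Ω φ ψ ρ V₀) (hP : P.Finite)
    (hPΩ : ∀ p ∈ P, p ∉ frontier Ω) :
    ∃ r, 1 < r ∧ r < ρ ∧ ∀ p ∈ V₀ ∩ P, r⁻¹ < ‖φ p‖ → r ≤ ‖φ p‖ := by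
  have hinv : Tendsto (fun r : ℝ => r⁻¹) (𝓝[>] 1) (𝓝 1) := by
    have := (tendsto_inv₀ (one_ne_zero (α := ℝ))).mono_left (nhdsWithin_le_nhds (s := Ioi 1))
    simpa using this
  have h1 : ∀ p ∈ V₀ ∩ P, ∀ᶠ r in 𝓝[>] (1 : ℝ), r⁻¹ < ‖φ p‖ → r ≤ ‖φ p‖ := by
    rintro p ⟨hpV, hpP⟩
    have hne : ‖φ p‖ ≠ 1 := fun h => hPΩ p hpP ((hc.frontier_iff p hpV).2 h)
    rcases hne.lt_or_gt with h | h
    · filter_upwards [hinv.eventually (lt_mem_nhds h)] with r hr hr'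
      exact absurd hr' hr.not_gt
    · filter_upwards [mem_nhdsWithin_of_mem_nhds (Iio_mem_nhds h)] with r hr _
      exact le_of_lt hr
  have h2 := (hP.subset inter_subset_right).eventually_all.2 h1
  obtain ⟨r, hr, hr1⟩ := (h2.and (Ioo_mem_nhdsGT hc.one_lt)).exists
  exact ⟨r, hr1.1, hr1.2, hr⟩

/-- The anti-holomorphic reflection in the boundary curve, followed by complex conjugation. -/
def reflection (φ ψ : ℂ → ℂ) (z : ℂ) : ℂ := (starRingEnd ℂ) (ψ ((starRingEnd ℂ) (φ z)))

theorem conj_mem_punctured {ζ : ℂ} (hζ : ζ ∈ Metric.ball (0 : ℂ) ρ \ {0}) :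
    (starRingEnd ℂ) ζ ∈ Metric.ball (0 : ℂ) ρ \ {0} := by
  simpa using hζ

theorem differentiableAt_reflection (hc : ExteriorChart Ω φ ψ ρ V₀) {z : ℂ} (hz : z ∈ V₀)
    (hzρ : ‖φ z‖ < ρ) : DifferentiableAt ℂ (reflection φ ψ) z := by
  have hm : φ z ∈ Metric.ball (0 : ℂ) ρ \ {0} := ⟨by simpa using hzρ, hc.ne_zero hz⟩
  have h1 : DifferentiableAt ℂ ψ ((starRingEnd ℂ) (φ z)) :=
    hc.inv_holomorphic.differentiableAt ((isOpen_punctured ρ).mem_nhds (conj_mem_punctured hm))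
  have h2 := h1.conj_conj
  rw [Complex.conj_conj] at h2
  exact h2.comp z (hc.holomorphic.differentiableAt (hc.isOpen.mem_nhds hz))

theorem analyticAt_reflection (hc : ExteriorChart Ω φ ψ ρ V₀) {z : ℂ} (hz : z ∈ V₀)
    (hzρ : ‖φ z‖ < ρ) : AnalyticAt ℂ (reflection φ ψ) z := by
  have hopen : IsOpen (V₀ ∩ {z | ‖φ z‖ < ρ}) :=
    hc.holomorphic.continuousOn.norm.isOpen_inter_preimage hc.isOpen isOpen_Iio
  refine DifferentiableOn.analyticAt (s := V₀ ∩ {z | ‖φ z‖ < ρ})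
    (fun w hw => (hc.differentiableAt_reflection hw.1 hw.2).differentiableWithinAt)
    (hopen.mem_nhds ⟨hz, hzρ⟩)

theorem reflection_of_mem_frontier (hc : ExteriorChart Ω φ ψ ρ V₀) {z : ℂ}
    (hz : z ∈ frontier Ω) : reflection φ ψ z = (starRingEnd ℂ) z := by
  have hzV := hc.closure_subset (frontier_subset_closure hz)
  have h1 := (hc.frontier_iff z hzV).1 hz
  have h2 : (starRingEnd ℂ) (φ z) = (φ z)⁻¹ := by
    rw [Complex.inv_def, Complex.normSq_eq_norm_sq, h1]; simp
  rw [reflection, h2, hc.left_inv z hzV]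

/-- A function on the exterior domain with boundary values `z̄` coincides near the boundary with
the reflection. -/
theorem eq_reflection (hc : ExteriorChart Ω φ ψ ρ V₀) {F : ℂ → ℂ}
    (hF : ∀ z ∈ Ω, ‖φ z‖ < ρ → DifferentiableAt ℂ F z)
    (hFc : ∀ z ∈ frontier Ω, ContinuousWithinAt F (closure Ω) z)
    (hFb : ∀ z ∈ frontier Ω, F z = (starRingEnd ℂ) z) {z : ℂ} (hz : z ∈ Ω) (hzρ : ‖φ z‖ < ρ) :
    F z = reflection φ ψ z := by
  have hzV := hc.closure_subset (subset_closure hz)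
  have hζρ : ρ⁻¹ < ‖(φ z)⁻¹‖ := by
    rw [norm_inv]
    exact (inv_lt_inv₀ hc.pos (norm_pos_iff.2 (hc.ne_zero hzV))).2 hzρ
  have hζ1 : ‖(φ z)⁻¹‖ < 1 := by
    rw [norm_inv]
    exact inv_lt_one_of_one_lt₀ ((hc.mem_iff z hzV).1 hz)
  -- In the coordinate `ζ` the comparison takes place on `s < |ζ| < 1`, whose outer circle
  -- corresponds to the boundary of `Ω`.
  obtain ⟨s, hs1, hs2⟩ := exists_between hζρ
  have hs0 : 0 < s := (inv_pos.2 hc.pos).trans hs1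
  have hmem : ∀ ζ : ℂ, s ≤ ‖ζ‖ → ‖ζ‖ ≤ 1 → ζ ∈ Metric.ball (0 : ℂ) ρ \ {0} := fun ζ h1 h2 =>
    ⟨by simpa using h2.trans_lt hc.one_lt, norm_pos_iff.1 (hs0.trans_le h1)⟩
  have hlt : ∀ ζ : ℂ, s ≤ ‖ζ‖ → ‖ζ‖ ≤ 1 → ‖φ (ψ ζ)‖ < ρ := fun ζ h1 h2 => by
    rw [hc.right_inv ζ (hmem ζ h1 h2), norm_inv]
    exact (inv_lt_comm₀ hc.pos (hs0.trans_le h1)).1 (hs1.trans_le h1)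
  have hψd : ∀ ζ : ℂ, s ≤ ‖ζ‖ → ‖ζ‖ ≤ 1 → DifferentiableAt ℂ ψ ζ := fun ζ h1 h2 =>
    hc.inv_holomorphic.differentiableAt ((isOpen_punctured ρ).mem_nhds (hmem ζ h1 h2))
  have hψΩ : ∀ ζ : ℂ, s ≤ ‖ζ‖ → ‖ζ‖ < 1 → ψ ζ ∈ Ω := fun ζ h1 h2 =>
    hc.inv_mem_domain (hmem ζ h1 h2.le).2 h2
  have hσ : ∀ ζ : ℂ, s ≤ ‖ζ‖ → ‖ζ‖ ≤ 1 →
      DifferentiableAt ℂ (fun ζ => reflection φ ψ (ψ ζ)) ζ := fun ζ h1 h2 =>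
    (hc.differentiableAt_reflection (hc.inv_mem ζ (hmem ζ h1 h2)) (hlt ζ h1 h2)).comp ζ
      (hψd ζ h1 h2)
  have hcl : MapsTo ψ {ζ | s ≤ ‖ζ‖ ∧ ‖ζ‖ ≤ 1} (closure Ω) := by
    rintro ζ ⟨h1, h2⟩
    rcases h2.lt_or_eq with h3 | h3
    · exact subset_closure (hψΩ ζ h1 h3)
    · exact frontier_subset_closure (hc.inv_mem_frontier h3)
  have key := eq_zero_of_annulus (g := fun ζ => F (ψ ζ) - reflection φ ψ (ψ ζ)) hs0 ?_ ?_ ?_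
    hs2 hζ1
  · rw [hc.left_inv z hzV] at key
    exact sub_eq_zero.1 key
  · rintro ζ ⟨h1, h2⟩
    have h3 := (hF _ (hψΩ ζ h1.le h2) (hlt ζ h1.le h2.le)).comp ζ (hψd ζ h1.le h2.le)
    exact (h3.sub (hσ ζ h1.le h2.le)).differentiableWithinAt
  · rintro ζ ⟨h1, h2⟩
    refine ContinuousWithinAt.sub ?_ (hσ ζ h1 h2).continuousAt.continuousWithinAt
    have h4 : ContinuousWithinAt F (closure Ω) (ψ ζ) := by
      rcases h2.lt_or_eq with h3 | h3
      · exact (hF _ (hψΩ ζ h1 h3) (hlt ζ h1 h2)).continuousAt.continuousWithinAt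
      · exact hFc _ (hc.inv_mem_frontier h3)
    exact h4.comp (hψd ζ h1 h2).continuousAt.continuousWithinAt hcl
  · intro ζ h1
    have h2 := hc.inv_mem_frontier h1
    simp only [hFb _ h2, hc.reflection_of_mem_frontier h2, sub_self]

/-- A meromorphic function on the exterior domain with boundary values `z̄` gives rise to a Schwarz
function that extends across the boundary. -/
theorem exists_isSchwarzFunction (hc : ExteriorChart Ω φ ψ ρ V₀) (hΩ : IsOpen Ω)
    (hΩc : IsConnected Ω) (hΩb : Bornology.IsBounded Ωᶜ) (hP : P.Finite)
    (hPρ : ∀ p ∈ V₀ ∩ P, ρ ≤ ‖φ p‖) {F : ℂ → ℂ} (hFm : MeromorphicOn F Ω)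
    (hF : ∀ z ∈ Ω \ P, AnalyticAt ℂ F z)
    (hFc : ∀ z ∈ frontier Ω, ContinuousWithinAt F (closure Ω) z)
    (hFb : ∀ z ∈ frontier Ω, F z = (starRingEnd ℂ) z)
    (hFinf : MeromorphicAt (fun z => F z⁻¹) 0) :
    ∃ S : ℂ → ℂ, IsSchwarzFunction Ω S ∧ AnalyticOnNhd ℂ S (V₀ \ P) ∧ ∀ z ∈ Ω \ P, S z = F z := by
  classical
  -- The two branches agree on the part of `Ω` with `|φ| < ρ`, so the glued function is holomorphic
  -- across the boundary.
  set S : ℂ → ℂ := fun z => if z ∈ Ω then toMeromorphicNFOn F Ω z else reflection φ ψ z with hS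
  have hSF : ∀ z ∈ Ω \ P, S z = F z := fun z hz => by
    simp only [hS, hz.1, if_true]
    exact toMeromorphicNFOn_apply_of_analyticAt hFm hz.1 (hF z hz)
  have hSref : ∀ z ∈ V₀, ‖φ z‖ < ρ → S z = reflection φ ψ z := by
    intro z hz hzρ
    by_cases hzΩ : z ∈ Ω
    · have hzP : ∀ w ∈ Ω, ‖φ w‖ < ρ → w ∉ P := fun w hw hwρ hwP =>
        (hPρ w ⟨hc.closure_subset (subset_closure hw), hwP⟩).not_gt hwρ
      rw [hSF z ⟨hzΩ, hzP z hzΩ hzρ⟩]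
      exact hc.eq_reflection (fun w hw hwρ => (hF w ⟨hw, hzP w hw hwρ⟩).differentiableAt) hFc hFb
        hzΩ hzρ
    · simp only [hS, hzΩ, if_false]
  have hSan : AnalyticOnNhd ℂ S (V₀ \ P) := by
    rintro z ⟨hz, hzP⟩
    by_cases hzΩ : z ∈ Ω
    · refine (hF z ⟨hzΩ, hzP⟩).congr ?_
      filter_upwards [(hΩ.sdiff hP.isClosed).mem_nhds ⟨hzΩ, hzP⟩] with w hw using (hSF w hw).symm
    · have hzρ : ‖φ z‖ < ρ :=
        (not_lt.1 fun h => hzΩ ((hc.mem_iff z hz).2 h)).trans_lt hc.one_lt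
      refine (hc.analyticAt_reflection hz hzρ).congr ?_
      have hopen : IsOpen (V₀ ∩ {z | ‖φ z‖ < ρ}) :=
        hc.holomorphic.continuousOn.norm.isOpen_inter_preimage hc.isOpen isOpen_Iio
      filter_upwards [hopen.mem_nhds ⟨hz, hzρ⟩] with w hw using (hSref w hw.1 hw.2).symm
  have hfr : ∀ z ∈ frontier Ω, z ∈ V₀ ∧ ‖φ z‖ < ρ := fun z hz => by
    have hzV := hc.closure_subset (frontier_subset_closure hz)
    exact ⟨hzV, by rw [(hc.frontier_iff z hzV).1 hz]; exact hc.one_lt⟩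
  refine ⟨S, ⟨hΩ, hΩc, hc.interior_closure hΩ, ?_, fun _ => ⟨hΩb, ?_⟩, ?_, ?_⟩, hSan, hSF⟩
  · intro z hz
    refine (meromorphicNFAt_congr ?_).1 (meromorphicNFOn_toMeromorphicNFOn F Ω hz)
    filter_upwards [hΩ.mem_nhds hz] with w hw
    simp only [hS, hw, if_true]
  · refine hFinf.congr ?_
    have h1 : ∀ᶠ z in Bornology.cobounded ℂ, z ∈ Ω \ P := by
      have h2 : (Ωᶜ)ᶜ ∈ Bornology.cobounded ℂ := Bornology.isBounded_def.1 hΩb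
      have h3 : Pᶜ ∈ Bornology.cobounded ℂ := Bornology.isBounded_def.1 hP.isBounded
      filter_upwards [h2, h3] with z hz1 hz2 using ⟨by simpa using hz1, hz2⟩
    filter_upwards [tendsto_inv₀_nhdsNE_zero.eventually h1] with z hz using (hSF _ hz).symm
  · intro z hz
    have hzP : z ∉ P := fun h => (hPρ z ⟨(hfr z hz).1, h⟩).not_gt (hfr z hz).2
    exact (hSan z ⟨(hfr z hz).1, hzP⟩).continuousAt.continuousWithinAt
  · intro z hz
    rw [hSref z (hfr z hz).1 (hfr z hz).2, hc.reflection_of_mem_frontier hz]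

end ExteriorChart

/-! ### Real functions with a given differential `Re (c dz)` -/

/-- The real differential of `f` at `z` is `v ↦ Re (c v)`. -/
def HasReDifferentialAt (f : ℂ → ℝ) (c z : ℂ) : Prop :=
  HasFDerivAt f (reCLM.comp (ContinuousLinearMap.mul ℝ ℂ c)) z

theorem HasReDifferentialAt.sub {f g : ℂ → ℝ} {c d z : ℂ} (hf : HasReDifferentialAt f c z)
    (hg : HasReDifferentialAt g d z) : HasReDifferentialAt (fun z => f z - g z) (c - d) z := by
  unfold HasReDifferentialAt at *
  rw [map_sub, ContinuousLinearMap.comp_sub]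
  exact hf.sub hg

theorem HasReDifferentialAt.const_mul {f : ℂ → ℝ} {c z : ℂ} (a : ℝ)
    (hf : HasReDifferentialAt f c z) : HasReDifferentialAt (fun z => a * f z) (a * c) z := by
  unfold HasReDifferentialAt at *
  have e : (a : ℂ) * c = a • c := (real_smul).symm
  rw [e, map_smul, ContinuousLinearMap.comp_smul]
  exact hf.const_mul a

theorem HasReDifferentialAt.comp_hasDerivAt {f : ℂ → ℝ} {c : ℂ} {γ : ℝ → ℂ} {v : ℂ} {t : ℝ}
    (hf : HasReDifferentialAt f c (γ t)) (hγ : HasDerivAt γ v t) :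
    HasDerivAt (fun s => f (γ s)) (c * v).re t := by
  exact HasFDerivAt.comp_hasDerivAt t hf hγ

theorem hasReDifferentialAt_re {q : ℂ → ℂ} {c z : ℂ} (hq : HasDerivAt q c z) :
    HasReDifferentialAt (fun z => (q z).re) c z := by
  have h1 := (hq.hasFDerivAt.restrictScalars ℝ)
  have h2 := reCLM.hasFDerivAt.comp z h1
  unfold HasReDifferentialAt
  convert! h2 using 1
  ext v
  simp [mul_comm]

theorem hasReDifferentialAt_of_differentiableAt {f : ℂ → ℝ} {z : ℂ}
    (hf : DifferentiableAt ℝ f z) : HasReDifferentialAt f (2 * wirtinger f z) z := by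
  have h := hf.hasFDerivAt
  unfold HasReDifferentialAt
  convert! h using 1
  ext v
  rw [fderiv_apply_eq_wirtinger]
  simp [mul_assoc]

theorem hasReDifferentialAt_norm_sq (z : ℂ) :
    HasReDifferentialAt (fun z => ‖z‖ ^ 2) (2 * (starRingEnd ℂ) z) z := by
  have h : DifferentiableAt ℝ (fun z : ℂ => ‖z‖ ^ 2) z :=
    (contDiff_norm_sq ℝ (n := 1)).differentiable one_ne_zero z
  have h1 := hasReDifferentialAt_of_differentiableAt h
  convert! h1 using 2
  rw [wirtinger, fderiv_norm_sq_eq_inner, fderiv_norm_sq_eq_inner]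
  apply Complex.ext <;> simp [Complex.inner]
  ring

theorem HasReDifferentialAt.comp {g : ℂ → ℝ} {f : ℂ → ℂ} {c d z : ℂ}
    (hg : HasReDifferentialAt g d (f z)) (hf : HasDerivAt f c z) :
    HasReDifferentialAt (fun z => g (f z)) (d * c) z := by
  have h2 := HasFDerivAt.comp z hg (hf.hasFDerivAt.restrictScalars ℝ)
  unfold HasReDifferentialAt
  convert! h2 using 1
  ext v
  simp [mul_comm v, mul_assoc]

theorem hasReDifferentialAt_log_norm {f : ℂ → ℂ} {c z : ℂ} (hf : HasDerivAt f c z)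
    (h0 : f z ≠ 0) : HasReDifferentialAt (fun z => Real.log ‖f z‖) (c / f z) z := by
  have h1 : HasReDifferentialAt (fun w : ℂ => Real.log (‖w‖ ^ 2))
      (((‖f z‖ ^ 2)⁻¹ : ℝ) * (2 * (starRingEnd ℂ) (f z))) (f z) := by
    have h2 := HasFDerivAt.log (hasReDifferentialAt_norm_sq (f z)) (by positivity)
    unfold HasReDifferentialAt
    convert! h2 using 1
    rw [← real_smul, map_smul, ContinuousLinearMap.comp_smul]
  have h3 := (h1.comp hf).const_mul (1 / 2)
  have h4 : (fun z => Real.log ‖f z‖) = fun z => 1 / 2 * Real.log (‖f z‖ ^ 2) := by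
    ext s; rw [Real.log_pow]; push_cast; ring
  rw [h4]
  convert! h3 using 1
  rw [div_eq_mul_inv, Complex.inv_def, Complex.normSq_eq_norm_sq]
  push_cast
  ring

/-! ### Path integrals of exact forms -/

namespace IsPathIn

variable {D : Set ℂ} {a b : ℂ} {γ : ℝ → ℂ} {f g : ℂ → ℂ}

theorem hasDerivAt (hγ : IsPathIn D a b γ) {t : ℝ} (ht : t ∈ Ioo (0 : ℝ) 1) :
    HasDerivAt γ (deriv γ t) t :=
  ((hγ.contDiffOn.differentiableOn one_ne_zero).differentiableAt
    (Icc_mem_nhds ht.1 ht.2)).hasDerivAt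

theorem intervalIntegrable (hγ : IsPathIn D a b γ) (hf : ContinuousOn f D) :
    IntervalIntegrable (fun t => f (γ t) * deriv γ t) volume 0 1 := by
  have h1 : ContinuousOn (fun t => f (γ t) * derivWithin γ (Icc 0 1) t) (Icc 0 1) :=
    (hf.comp hγ.contDiffOn.continuousOn hγ.mapsTo).mul
      (hγ.contDiffOn.continuousOn_derivWithin (uniqueDiffOn_Icc one_pos) le_rfl)
  have h2 : IntervalIntegrable (fun t => f (γ t) * derivWithin γ (Icc 0 1) t) volume 0 1 :=
    ContinuousOn.intervalIntegrable (by rwa [uIcc_of_le zero_le_one])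
  -- `deriv γ` may be meaningless at the endpoints; on the open interval it equals the one-sided
  -- derivative.
  rw [intervalIntegrable_iff_integrableOn_Ioo_of_le zero_le_one] at h2 ⊢
  refine h2.congr_fun (fun t ht => ?_) measurableSet_Ioo
  simp only [derivWithin_of_mem_nhds (Icc_mem_nhds ht.1 ht.2)]

theorem pathIntegral_sub (hγ : IsPathIn D a b γ) (hf : ContinuousOn f D) (hg : ContinuousOn g D) :
    pathIntegral (fun u => f u - g u) γ = pathIntegral f γ - pathIntegral g γ := by
  rw [pathIntegral, pathIntegral, pathIntegral,
    ← intervalIntegral.integral_sub (hγ.intervalIntegrable hf) (hγ.intervalIntegrable hg)]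
  simp only [sub_mul]

theorem pathIntegral_const_mul (c : ℂ) (f : ℂ → ℂ) (γ : ℝ → ℂ) :
    pathIntegral (fun u => c * f u) γ = c * pathIntegral f γ := by
  rw [pathIntegral, pathIntegral, ← intervalIntegral.integral_const_mul]
  simp only [mul_assoc]

theorem pathIntegral_eq_sub (hγ : IsPathIn D a b γ) (hf : ContinuousOn f D)
    (hg : ∀ z ∈ D, HasDerivAt g (f z) z) : pathIntegral f γ = g b - g a := by
  have hmaps : ∀ t ∈ Ioo (0 : ℝ) 1, γ t ∈ D := fun t ht => hγ.mapsTo (Ioo_subset_Icc_self ht)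
  have h := intervalIntegral.integral_eq_sub_of_hasDerivAt_of_le (f := fun t => g (γ t))
    (f' := fun t => f (γ t) * deriv γ t) zero_le_one
    (ContinuousOn.comp (t := D) (fun z hz => (hg z hz).continuousAt.continuousWithinAt)
      hγ.contDiffOn.continuousOn hγ.mapsTo)
    (fun t ht => (hg _ (hmaps t ht)).comp t (hγ.hasDerivAt ht)) (hγ.intervalIntegrable hf)
  rw [pathIntegral, h, hγ.source, hγ.target]

theorem re_pathIntegral_eq_sub (hγ : IsPathIn D a b γ) (hf : ContinuousOn f D) {R : ℂ → ℝ}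
    (hR : ∀ z ∈ D, HasReDifferentialAt R (f z) z) : (pathIntegral f γ).re = R b - R a := by
  have hmaps : ∀ t ∈ Ioo (0 : ℝ) 1, γ t ∈ D := fun t ht => hγ.mapsTo (Ioo_subset_Icc_self ht)
  have hint := hγ.intervalIntegrable hf
  have h := intervalIntegral.integral_eq_sub_of_hasDerivAt_of_le (f := fun t => R (γ t))
    (f' := fun t => (f (γ t) * deriv γ t).re) zero_le_one
    (ContinuousOn.comp (t := D)
      (fun z hz => (HasFDerivAt.continuousAt (hR z hz)).continuousWithinAt)
      hγ.contDiffOn.continuousOn hγ.mapsTo)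
    (fun t ht => (hR _ (hmaps t ht)).comp_hasDerivAt (hγ.hasDerivAt ht))
    ⟨hint.1.re, hint.2.re⟩
  rw [hγ.source, hγ.target] at h
  rw [← h, pathIntegral]
  exact (reCLM.intervalIntegral_comp_comm hint).symm

end IsPathIn

/-! ### Primitives, uniqueness and constancy on the boundary in the exterior chart -/

namespace ExteriorChart

variable {Ω V₀ P W : Set ℂ} {φ ψ : ℂ → ℂ} {ρ : ℝ}

theorem hasDerivAt_chart (hc : ExteriorChart Ω φ ψ ρ V₀) {z : ℂ} (hz : z ∈ V₀) :
    HasDerivAt φ (deriv φ z) z :=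
  (hc.holomorphic.differentiableAt (hc.isOpen.mem_nhds hz)).hasDerivAt

theorem hasDerivAt_inv (hc : ExteriorChart Ω φ ψ ρ V₀) {ζ : ℂ}
    (hζ : ζ ∈ Metric.ball (0 : ℂ) ρ \ {0}) : HasDerivAt ψ (deriv ψ ζ) ζ :=
  (hc.inv_holomorphic.differentiableAt ((isOpen_punctured ρ).mem_nhds hζ)).hasDerivAt

theorem hasDerivAt_chart_inv (hc : ExteriorChart Ω φ ψ ρ V₀) {z : ℂ} (hz : z ∈ V₀) :
    HasDerivAt (fun z => (φ z)⁻¹) (-deriv φ z / φ z ^ 2) z :=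
  (hc.hasDerivAt_chart hz).fun_inv (hc.ne_zero hz)

theorem deriv_inv_mul (hc : ExteriorChart Ω φ ψ ρ V₀) {z : ℂ} (hz : z ∈ V₀) :
    deriv ψ (φ z)⁻¹ * (-deriv φ z / φ z ^ 2) = 1 := by
  have h1 : HasDerivAt (fun z => ψ (φ z)⁻¹) (deriv ψ (φ z)⁻¹ * (-deriv φ z / φ z ^ 2)) z :=
    (hc.hasDerivAt_inv (hc.inv_mem_ball hz)).comp z (hc.hasDerivAt_chart_inv hz)
  refine h1.unique ((hasDerivAt_id z).congr_of_eventuallyEq ?_)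
  filter_upwards [hc.isOpen.mem_nhds hz] with w hw using hc.left_inv w hw

/-- `k(ζ) = ζ ψ(ζ)` extends holomorphically over 0 with value `c`, and `ζ² ψ' = ζ k' - k`. -/
theorem tendsto_sq_mul_deriv_inv (hc : ExteriorChart Ω φ ψ ρ V₀) {c : ℂ}
    (h : Tendsto (fun ζ => ζ * ψ ζ) (𝓝[≠] 0) (𝓝 c)) :
    Tendsto (fun ζ => ζ ^ 2 * deriv ψ ζ) (𝓝[≠] 0) (𝓝 (-c)) := by
  classical
  set k : ℂ → ℂ := Function.update (fun ζ => ζ * ψ ζ) 0 c with hk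
  have hkne : ∀ ζ, ζ ≠ 0 → k ζ = ζ * ψ ζ := fun ζ hζ => by
    rw [hk, Function.update_of_ne hζ]
  have hk0 : k 0 = c := Function.update_self ..
  have hkc : ContinuousAt k 0 := continuousAt_update_same.2 h
  have hkd : ∀ ζ ∈ Metric.ball (0 : ℂ) ρ \ {0},
      HasDerivAt k (1 * ψ ζ + ζ * deriv ψ ζ) ζ := fun ζ hζ => by
    refine ((hasDerivAt_id ζ).mul (hc.hasDerivAt_inv hζ)).congr_of_eventuallyEq ?_
    filter_upwards [isOpen_ne.mem_nhds hζ.2] with w hw using hkne w hw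
  have hka : AnalyticAt ℂ k 0 :=
    analyticAt_of_differentiable_on_punctured_nhds_of_continuousAt
      (by filter_upwards [hc.punctured_mem_nhdsNE] with ζ hζ using (hkd ζ hζ).differentiableAt) hkc
  have hlim : Tendsto (fun ζ => ζ * deriv k ζ - k ζ) (𝓝[≠] 0) (𝓝 (0 * deriv k 0 - k 0)) :=
    ((continuousAt_id.mul hka.deriv.continuousAt).sub hkc).tendsto.mono_left nhdsWithin_le_nhds
  rw [zero_mul, zero_sub, hk0] at hlim
  refine hlim.congr' ?_
  filter_upwards [hc.punctured_mem_nhdsNE] with ζ hζ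
  rw [(hkd ζ hζ).deriv, hkne ζ hζ.2]
  ring

/-- A holomorphic function `B` with `B(z) ~ 1/z` at infinity is half the derivative of
`q + 2 log φ` for some function `q` that is holomorphic also at infinity. -/
theorem exists_primitive (hc : ExteriorChart Ω φ ψ ρ V₀) {B : ℂ → ℂ}
    (hB : DifferentiableOn ℂ B V₀)
    (hBinf : Tendsto (fun z => z * B z) (Bornology.cobounded ℂ) (𝓝 1)) :
    ∃ p : ℂ → ℂ, DifferentiableOn ℂ p (Metric.ball 0 ρ) ∧
      ∀ z ∈ V₀, HasDerivAt (fun z => p (φ z)⁻¹) (2 * B z - 2 * (deriv φ z / φ z)) z := by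
  classical
  -- This is the form `2 B dz - 2 dφ/φ` in the coordinate `ζ = 1/φ`, where `dφ/φ = -dζ/ζ`.
  set g : ℂ → ℂ := fun ζ => 2 * (B (ψ ζ) * deriv ψ ζ) + 2 * ζ⁻¹ with hg
  obtain ⟨c, hc0, hlim⟩ := hc.tendsto_inv
  have hcne : (c : ℂ) ≠ 0 := by exact_mod_cast hc0.ne'
  have h1 : Tendsto (fun ζ => ψ ζ * B (ψ ζ)) (𝓝[≠] 0) (𝓝 1) := hBinf.comp hc.tendsto_cobounded
  have h2 := (h1.div hlim hcne).mul (hc.tendsto_sq_mul_deriv_inv hlim)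
  -- The residues at `ζ = 0` cancel: the `B` term contributes `2 · (1/c) · (-c) = -2`. So the
  -- singularity is removable.
  have h3 : Tendsto (fun ζ => ζ * g ζ) (𝓝[≠] 0) (𝓝 0) := by
    have h4 := (h2.const_mul 2).add_const 2
    have e : 2 * (1 / (c : ℂ) * -c) + 2 = 0 := by field_simp; ring
    rw [e] at h4
    refine h4.congr' ?_
    filter_upwards [self_mem_nhdsWithin, hc.tendsto_cobounded.eventually
      (Bornology.isBounded_def.1 (Bornology.isBounded_singleton (x := (0 : ℂ))))] with ζ hζ hψ
    have hζ : ζ ≠ 0 := hζ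
    have hψ : ψ ζ ≠ 0 := hψ
    simp only [hg, Pi.div_apply]
    field_simp
  have hgd : DifferentiableOn ℂ g (Metric.ball 0 ρ \ {0}) := by
    have hψd : DifferentiableOn ℂ (deriv ψ) (Metric.ball 0 ρ \ {0}) :=
      hc.inv_holomorphic.deriv (isOpen_punctured ρ)
    have hBψ : DifferentiableOn ℂ (fun ζ => B (ψ ζ)) (Metric.ball 0 ρ \ {0}) :=
      hB.comp hc.inv_holomorphic fun ζ hζ => hc.inv_mem ζ hζ
    exact ((hBψ.mul hψd).const_mul 2).add
      ((differentiableOn_inv.mono fun z hz => hz.2).const_mul 2)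
  have hupd := differentiableOn_update_limUnder_of_isLittleO
    (Metric.ball_mem_nhds (0 : ℂ) hc.pos) hgd (by
      rw [Asymptotics.isLittleO_iff_tendsto']
      · have h5 : Tendsto (fun ζ => ζ * g ζ - ζ * g 0) (𝓝[≠] 0) (𝓝 (0 - 0 * g 0)) :=
          h3.sub ((continuous_id.tendsto (0 : ℂ)).mono_left nhdsWithin_le_nhds |>.mul_const _)
        rw [zero_mul, sub_zero] at h5
        refine h5.congr fun ζ => ?_
        rw [sub_zero, div_inv_eq_mul]; ring
      · filter_upwards [self_mem_nhdsWithin] with ζ hζ h0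
        exact absurd h0 (inv_ne_zero (by simpa using hζ)))
  obtain ⟨p, hp⟩ := hupd.isExactOn_ball
  refine ⟨p, fun ζ hζ => (hp ζ hζ).differentiableAt.differentiableWithinAt, fun z hz => ?_⟩
  have hζ := hc.inv_mem_ball hz
  have h6 := (hp _ hζ.1).comp z (hc.hasDerivAt_chart_inv hz)
  convert! h6 using 1
  rw [Function.update_of_ne hζ.2]
  simp only [hg, hc.left_inv z hz, inv_inv]
  have h7 := hc.deriv_inv_mul hz
  have h8 := hc.ne_zero hz
  calc 2 * B z - 2 * (deriv φ z / φ z)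
      = 2 * B z * (deriv ψ (φ z)⁻¹ * (-deriv φ z / φ z ^ 2))
        + 2 * φ z * (-deriv φ z / φ z ^ 2) := by
        rw [h7]; field_simp; ring
    _ = _ := by ring

/-- The bounded holomorphic function on a neighbourhood of the closure of the exterior domain is
determined by its real part on the boundary and its imaginary part at infinity. -/
theorem eqOn_of_isHarmonicContinuation (hc : ExteriorChart Ω φ ψ ρ V₀) {Q : ℂ → ℝ} {q q' : ℂ → ℂ}
    (hW : IsPreconnected W) (hWV : W ⊆ V₀) (hΩ : IsOpen Ω) (hΩne : Ω.Nonempty)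
    (hq : IsHarmonicContinuation Q Ω W q) (hq' : IsHarmonicContinuation Q Ω W q') :
    EqOn q q' W := by
  classical
  set p : ℂ → ℂ := fun ζ => q (ψ ζ) - q' (ψ ζ) with hp
  have hmem : ∀ ζ : ℂ, ζ ≠ 0 → ‖ζ‖ ≤ 1 → ζ ∈ Metric.ball (0 : ℂ) ρ \ {0} := fun ζ h0 h1 =>
    ⟨by simpa using h1.trans_lt hc.one_lt, h0⟩
  have hψW : ∀ ζ : ℂ, ζ ≠ 0 → ‖ζ‖ ≤ 1 → ψ ζ ∈ W := by
    intro ζ h0 h1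
    refine hq.closure_subset ?_
    rcases h1.lt_or_eq with h2 | h2
    · exact subset_closure (hc.inv_mem_domain h0 h2)
    · exact frontier_subset_closure (hc.inv_mem_frontier h2)
  have hpd : ∀ ζ : ℂ, ζ ≠ 0 → ‖ζ‖ ≤ 1 → DifferentiableAt ℂ p ζ := by
    intro ζ h0 h1
    have hd := (hc.hasDerivAt_inv (hmem ζ h0 h1)).differentiableAt
    have hWn := hq.isOpen.mem_nhds (hψW ζ h0 h1)
    exact ((hq.holomorphic.differentiableAt hWn).comp ζ hd).sub
      ((hq'.holomorphic.differentiableAt hWn).comp ζ hd)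
  obtain ⟨M, hM⟩ := hq.bounded
  obtain ⟨M', hM'⟩ := hq'.bounded
  set u : ℂ → ℂ := Function.update p 0 (limUnder (𝓝[≠] 0) p) with hu
  -- Boundedness of both continuations makes the point at infinity, `ζ = 0`, removable.
  have hupd : DifferentiableOn ℂ u (Metric.ball 0 1) := by
    refine differentiableOn_update_limUnder_of_bddAbove (Metric.ball_mem_nhds 0 one_pos)
      (fun ζ hζ => (hpd ζ hζ.2 ((mem_ball_zero_iff.1 hζ.1).le)).differentiableWithinAt) ⟨M + M', ?_⟩
    rintro _ ⟨ζ, hζ, rfl⟩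
    have hw := hψW ζ hζ.2 (mem_ball_zero_iff.1 hζ.1).le
    exact (norm_sub_le _ _).trans (add_le_add (hM _ hw) (hM' _ hw))
  have hune : ∀ ζ, ζ ≠ 0 → u ζ = p ζ := fun ζ h => Function.update_of_ne h _ _
  have hud : DiffContOnCl ℂ u (Metric.ball 0 1) := by
    refine ⟨hupd, ?_⟩
    rw [closure_ball (0 : ℂ) one_ne_zero]
    intro ζ hζ
    by_cases h0 : ζ = 0
    · subst h0
      exact (hupd.continuousOn.continuousAt
        (Metric.ball_mem_nhds 0 one_pos)).continuousWithinAt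
    · refine ((hpd ζ h0 (by simpa using hζ)).continuousAt.congr ?_).continuousWithinAt
      filter_upwards [isOpen_ne.mem_nhds h0] with w hw using (hune w hw).symm
  have hre : ∀ ζ ∈ Metric.sphere (0 : ℂ) 1, (u ζ).re = 0 := by
    intro ζ hζ
    have hζ1 : ‖ζ‖ = 1 := by simpa using hζ
    have hfr := hc.inv_mem_frontier hζ1
    rw [hune ζ (norm_pos_iff.1 (by rw [hζ1]; exact one_pos))]
    simp only [hp, sub_re, hq.re_eq _ hfr, hq'.re_eq _ hfr, sub_self]
  -- The maximum principle for `Re v`, obtained from the maximum modulus principle for `exp v`.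
  have hle : ∀ {v : ℂ → ℂ}, DiffContOnCl ℂ v (Metric.ball 0 1) →
      (∀ ζ ∈ Metric.sphere (0 : ℂ) 1, (v ζ).re = 0) → ∀ ζ ∈ Metric.ball (0 : ℂ) 1,
      (v ζ).re ≤ 0 := by
    intro v hv hv0 ζ hζ
    have h1 := norm_le_of_forall_mem_frontier_norm_le (f := fun ζ => Complex.exp (v ζ)) (C := 1)
      (Metric.isBounded_ball (x := (0 : ℂ)) (r := 1))
      ⟨hv.differentiableOn.cexp, Complex.continuous_exp.comp_continuousOn hv.continuousOn⟩
      (fun z hz => by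
        rw [frontier_ball (0 : ℂ) one_ne_zero] at hz
        rw [Complex.norm_exp, hv0 z hz, Real.exp_zero]) (subset_closure hζ)
    rwa [Complex.norm_exp, Real.exp_le_one_iff] at h1
  have hzero : ∀ ζ ∈ Metric.ball (0 : ℂ) 1, (u ζ).re = 0 := fun ζ hζ => by
    refine le_antisymm (hle hud hre ζ hζ) ?_
    have := hle hud.neg (fun ζ hζ => by simp [hre ζ hζ]) ζ hζ
    simpa using this
  obtain ⟨c, hconst⟩ := AnalyticOnNhd.eq_const_of_re_eq_const
    (hupd.analyticOnNhd Metric.isOpen_ball) hzero Metric.isOpen_ball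
    ((convex_ball (0 : ℂ) 1).isConnected ⟨0, Metric.mem_ball_self one_pos⟩)
  have hnear : ∀ᶠ ζ in 𝓝[≠] (0 : ℂ), p ζ = c := by
    filter_upwards [self_mem_nhdsWithin,
      mem_nhdsWithin_of_mem_nhds (Metric.ball_mem_nhds (0 : ℂ) one_pos)] with ζ h0 h1
    rw [← hune ζ h0, hconst ζ h1]
  have hc0 : c = 0 := by
    apply Complex.ext
    · rw [← hconst 0 (Metric.mem_ball_self one_pos)]
      exact hzero 0 (Metric.mem_ball_self one_pos)
    · have h1 := (hq.im_infinity.sub hq'.im_infinity).comp hc.tendsto_cobounded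
      rw [sub_zero] at h1
      have h2 : Tendsto (fun _ : ℂ => c.im) (𝓝[≠] 0) (𝓝 0) := by
        refine h1.congr' ?_
        filter_upwards [hnear] with ζ hζ
        rw [← hζ]; rfl
      exact tendsto_nhds_unique tendsto_const_nhds h2
  have hΩeq : ∀ z ∈ Ω, q z = q' z := by
    intro z hz
    have hzV := hWV (hq.closure_subset (subset_closure hz))
    have h1 := hc.inv_mem_ball hzV
    have h2 : (φ z)⁻¹ ∈ Metric.ball (0 : ℂ) 1 := by
      rw [mem_ball_zero_iff, norm_inv]
      exact inv_lt_one_of_one_lt₀ ((hc.mem_iff z hzV).1 hz)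
    have h3 := hconst _ h2
    rw [hune _ h1.2, hc0] at h3
    simp only [hp, hc.left_inv z hzV] at h3
    exact sub_eq_zero.1 h3
  obtain ⟨z₀, hz₀⟩ := hΩne
  refine AnalyticOnNhd.eqOn_of_preconnected_of_eventuallyEq
    (hq.holomorphic.analyticOnNhd hq.isOpen) (hq'.holomorphic.analyticOnNhd hq.isOpen) hW
    (hq.closure_subset (subset_closure hz₀)) ?_
  filter_upwards [hΩ.mem_nhds hz₀] with z hz using hΩeq z hz

/-- A differentiable real function whose differential vanishes on the boundary curve is constant
there. -/
theorem eq_of_hasReDifferentialAt_zero (hc : ExteriorChart Ω φ ψ ρ V₀) {f : ℂ → ℝ}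
    (hf : ∀ z ∈ frontier Ω, HasReDifferentialAt f 0 z) {z w : ℂ} (hz : z ∈ frontier Ω)
    (hw : w ∈ frontier Ω) : f z = f w := by
  have hmem : ∀ θ : ℝ, ‖Complex.exp (θ * I)‖ = 1 := fun θ => Complex.norm_exp_ofReal_mul_I θ
  have hγ : ∀ θ : ℝ, HasDerivAt (fun θ : ℝ => f (ψ (Complex.exp (θ * I)))) 0 θ := by
    intro θ
    have h1 : HasDerivAt (fun θ : ℝ => Complex.exp (θ * I)) (Complex.exp (θ * I) * (1 * I)) θ :=
      ((ofRealCLM.hasDerivAt (x := θ)).mul_const I).cexp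
    have h2 : Complex.exp (θ * I) ∈ Metric.ball (0 : ℂ) ρ \ {0} :=
      ⟨by rw [mem_ball_zero_iff, hmem θ]; exact hc.one_lt, Complex.exp_ne_zero _⟩
    have h3 := (hc.hasDerivAt_inv h2).comp θ h1
    have h4 := HasReDifferentialAt.comp_hasDerivAt
      (γ := fun θ : ℝ => ψ (Complex.exp (θ * I))) (hf _ (hc.inv_mem_frontier (hmem θ))) h3
    simpa using h4
  have hpar : ∀ z ∈ frontier Ω, ∃ θ : ℝ, ψ (Complex.exp (θ * I)) = z := by
    intro z hz
    have hzV := hc.closure_subset (frontier_subset_closure hz)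
    refine ⟨Complex.arg (φ z)⁻¹, ?_⟩
    have h1 := Complex.norm_mul_exp_arg_mul_I (φ z)⁻¹
    rw [norm_inv, (hc.frontier_iff z hzV).1 hz] at h1
    rw [inv_one, ofReal_one, one_mul] at h1
    rw [h1, hc.left_inv z hzV]
  obtain ⟨s, rfl⟩ := hpar z hz
  obtain ⟨t, rfl⟩ := hpar w hw
  exact is_const_of_deriv_eq_zero (fun θ => (hγ θ).differentiableAt) (fun θ => (hγ θ).deriv) s t

end ExteriorChart

/-! ### The harmonic continuation and the remainder -/

theorem hasReDifferentialAt_remainder {t₀ : ℝ} {H : ℂ → ℝ} {h : RatFunc ℂ}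
    (hH : IsHarmonicWithRationalDerivative H h) {q φ : ℂ → ℂ} {c d z : ℂ} (hz : z ∉ poles h)
    (hq : HasDerivAt q c z) (hφ : HasDerivAt φ d z) (h0 : φ z ≠ 0) :
    HasReDifferentialAt (remainder (potential t₀ H) q φ)
      (2 * (((starRingEnd ℂ) z - h.eval (RingHom.id ℂ) z) / t₀) - c - 2 * (d / φ z)) z := by
  have h1 := hasReDifferentialAt_of_differentiableAt
    (analyticAt_potential (t₀ := t₀) hH hz).differentiableAt
  rw [wirtinger_potential hH hz] at h1
  exact_mod_cast (h1.sub (hasReDifferentialAt_re hq)).sub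
    ((hasReDifferentialAt_log_norm hφ h0).const_mul 2)

theorem analyticAt_remainder {t₀ : ℝ} {H : ℂ → ℝ} {h : RatFunc ℂ}
    (hH : IsHarmonicWithRationalDerivative H h) {q φ : ℂ → ℂ} {z : ℂ} (hz : z ∉ poles h)
    (hq : AnalyticAt ℂ q z) (hφ : AnalyticAt ℂ φ z) (h0 : φ z ≠ 0) :
    AnalyticAt ℝ (remainder (potential t₀ H) q φ) z := by
  have h1 : AnalyticAt ℝ (fun z => (q z).re) z :=
    (reCLM.analyticAt (q z)).comp hq.restrictScalars
  have h2 : AnalyticAt ℝ (fun z => Real.log ‖φ z‖) z :=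
    HarmonicAt.analyticAt (hφ.harmonicAt_log_norm h0)
  exact ((analyticAt_potential hH hz).sub h1).sub (analyticAt_const.mul h2)

/-- Since `z C(z) → 1`, the transform tends to 0 at infinity, where its singularity is therefore
removable. -/
theorem meromorphicAt_cauchyTransform_inv {μ : Measure ℂ} [IsProbabilityMeasure μ]
    (hμ : IsCompact μ.support) : MeromorphicAt (fun z => cauchyTransform μ z⁻¹) 0 := by
  classical
  have h1 := tendsto_mul_cauchyTransform hμ Measure.measure_compl_support
  have h2 : Tendsto (fun z => cauchyTransform μ z) (Bornology.cobounded ℂ) (𝓝 0) := by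
    have h3 := tendsto_inv₀_cobounded.mul h1
    rw [zero_mul] at h3
    refine h3.congr' ?_
    filter_upwards [Bornology.isBounded_def.1 (Bornology.isBounded_singleton (x := (0 : ℂ)))]
      with z hz
    rw [← mul_assoc, inv_mul_cancel₀ hz, one_mul]
  have h4 : Tendsto (fun z => cauchyTransform μ z⁻¹) (𝓝[≠] 0) (𝓝 0) :=
    h2.comp tendsto_inv₀_nhdsNE_zero
  have hopen : IsOpen μ.supportᶜ := Measure.isOpen_compl_support
  have h5 : AnalyticAt ℂ (Function.update (fun z => cauchyTransform μ z⁻¹) 0 0) 0 := by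
    refine analyticAt_of_differentiable_on_punctured_nhds_of_continuousAt ?_
      (continuousAt_update_same.2 h4)
    filter_upwards [tendsto_inv₀_nhdsNE_zero.eventually
      (Bornology.isBounded_def.1 hμ.isBounded), self_mem_nhdsWithin] with z hz hz0
    have h6 : DifferentiableAt ℂ (fun z => cauchyTransform μ z⁻¹) z :=
      ((differentiableOn_cauchyTransform μ).differentiableAt (hopen.mem_nhds hz)).comp z
        (differentiableAt_inv hz0)
    refine h6.congr_of_eventuallyEq ?_
    filter_upwards [isOpen_ne.mem_nhds hz0] with w hw using Function.update_of_ne hw _ _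
  refine h5.meromorphicAt.congr ?_
  filter_upwards [self_mem_nhdsWithin] with z hz using Function.update_of_ne hz _ _

theorem exists_schwarz_and_continuation {t₀ : ℝ} (ht₀ : 0 < t₀) {H : ℂ → ℝ} {h : RatFunc ℂ}
    (hH : IsHarmonicWithRationalDerivative H h) {K : Set ℂ}
    (hK : IsLocalDroplet (potential t₀ H) K) {V : Set ℂ} {φ : ℂ → ℂ}
    (hφ : IsExteriorConformalMap (outerDomain K) V φ) :
    ∃ (ψ : ℂ → ℂ) (ρ : ℝ) (V₀ : Set ℂ) (S q : ℂ → ℂ),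
      V₀ ⊆ V ∧ ExteriorChart (outerDomain K) φ ψ ρ V₀ ∧
      IsSchwarzFunction (outerDomain K) S ∧ AnalyticOnNhd ℂ S (V₀ \ poles h) ∧
      IsHarmonicContinuation (potential t₀ H) (outerDomain K) V₀ q ∧
      ∀ z ∈ V₀ \ poles h, HasDerivAt q
        (2 / t₀ * (S z - h.eval (RingHom.id ℂ) z) - 2 * (deriv φ z / φ z)) z := by
  classical
  have hKc : IsCompact K := by
    obtain ⟨U, -, -, hd⟩ := hK
    exact hd.isCompact
  set Ω := outerDomain K with hΩdef
  set μ := dropletMeasure (potential t₀ H) K with hμ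
  have hsupp : μ.support = K := by
    obtain ⟨U, -, -, hd⟩ := hK
    exact hd.support_eq
  have hprob : IsProbabilityMeasure μ := by
    obtain ⟨U, -, -, hd⟩ := hK
    exact hd.equilibrium.prob
  have htc : (t₀ : ℂ) ≠ 0 := by exact_mod_cast ht₀.ne'
  have hΩ : IsOpen Ω := isOpen_outerDomain hKc
  have hΩb : Bornology.IsBounded Ωᶜ := isBounded_compl_outerDomain hKc
  have hP := finite_poles h
  have hfrK : frontier Ω ⊆ K := frontier_outerDomain_subset hKc
  have hCcont : Continuous (cauchyTransform μ) :=
    continuous_cauchyTransform ENNReal.ofReal_ne_top (dropletMeasure_le hH K)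
  have hCdiff : DifferentiableOn ℂ (cauchyTransform μ) Ω :=
    (differentiableOn_cauchyTransform μ).mono fun z hz => by
      rw [hsupp]; exact outerDomain_subset_compl K hz
  obtain ⟨ψ, ρ₀, V', hV'V, hc₀⟩ := hφ.exists_chart hΩ
  obtain ⟨r, hr1, hrρ, hrP⟩ := hc₀.exists_radius_avoiding hP fun p hp hpf =>
    (hK.eval_eq ht₀ hH (hfrK hpf)).1 hp
  have hc₁ := hc₀.restrict hr1 hrρ.le
  set V₁ := V' ∩ {z | r⁻¹ < ‖φ z‖} with hV₁
  set F : ℂ → ℂ := fun z => h.eval (RingHom.id ℂ) z + t₀ * cauchyTransform μ z with hF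
  have hFan : ∀ z ∈ Ω \ poles h, AnalyticAt ℂ F z := fun z hz =>
    (analyticAt_eval hz.2).add
      (analyticAt_const.mul (hCdiff.analyticAt (hΩ.mem_nhds hz.1)))
  have hFm : MeromorphicOn F Ω := by
    intro z hz
    have h1 : MeromorphicAt (fun z => h.eval (RingHom.id ℂ) z) z := by
      simp only [eval_eq_div]
      exact (AnalyticOnNhd.eval_polynomial _ z trivial).meromorphicAt.div
        (AnalyticOnNhd.eval_polynomial _ z trivial).meromorphicAt
    exact h1.add (analyticAt_const.mul (hCdiff.analyticAt (hΩ.mem_nhds hz))).meromorphicAt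
  obtain ⟨S, hS, hSan, hSF⟩ := hc₁.exists_isSchwarzFunction hΩ (isConnected_outerDomain hKc) hΩb
    hP (fun p hp => hrP p ⟨hp.1.1, hp.2⟩ hp.1.2) hFm hFan
    (fun z hz => ((analyticAt_eval (hK.eval_eq ht₀ hH (hfrK hz)).1).continuousAt.add
      (continuousAt_const.mul hCcont.continuousAt)).continuousWithinAt)
    (fun z hz => by
      simp only [hF, (hK.eval_eq ht₀ hH (hfrK hz)).2]; ring)
    ((meromorphicAt_eval_inv h).add ((MeromorphicAt.const _ _).mul
      (meromorphicAt_cauchyTransform_inv (hsupp ▸ hKc))))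
  -- Using the Cauchy transform on `Ω` makes `B` holomorphic even at the poles of `∂H`, where those
  -- of `S` cancel.
  set B : ℂ → ℂ := fun z =>
    if z ∈ Ω then cauchyTransform μ z else (S z - h.eval (RingHom.id ℂ) z) / t₀ with hB
  have hBS : ∀ z, z ∉ poles h → B z = (S z - h.eval (RingHom.id ℂ) z) / t₀ := by
    intro z hzP
    by_cases hz : z ∈ Ω
    · simp only [hB, hz, if_true, hSF z ⟨hz, hzP⟩, hF]
      field_simp
      ring
    · simp only [hB, hz, if_false]
  have hPc : IsOpen (poles h)ᶜ := isOpen_compl_poles h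
  have hBd : DifferentiableOn ℂ B V₁ := by
    intro z hz
    refine DifferentiableAt.differentiableWithinAt ?_
    by_cases hzΩ : z ∈ Ω
    · refine (hCdiff.differentiableAt (hΩ.mem_nhds hzΩ)).congr_of_eventuallyEq ?_
      filter_upwards [hΩ.mem_nhds hzΩ] with w hw
      simp only [hB, hw, if_true]
    -- By the choice of `r`, every pole in `V₁` has `|φ| ≥ r > 1` and so lies in `Ω`.
    · have hzP : z ∉ poles h := fun hzP => hzΩ ((hc₁.mem_iff z hz).2
        (hr1.trans_le (hrP z ⟨hz.1, hzP⟩ hz.2)))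
      refine DifferentiableAt.congr_of_eventuallyEq (f := fun z =>
        (S z - h.eval (RingHom.id ℂ) z) / t₀) ?_ ?_
      · exact ((hSan z ⟨hz, hzP⟩).differentiableAt.sub
          (analyticAt_eval hzP).differentiableAt).div_const _
      · filter_upwards [hPc.mem_nhds hzP] with w hw using hBS w hw
  have hBinf : Tendsto (fun z => z * B z) (Bornology.cobounded ℂ) (𝓝 1) := by
    have h1 := tendsto_mul_cauchyTransform (μ := μ) (K := μ.support) (hsupp ▸ hKc)
      Measure.measure_compl_support
    refine h1.congr' ?_
    filter_upwards [Bornology.isBounded_def.1 hΩb] with z hz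
    have hz : z ∈ Ω := by simpa using hz
    simp only [hB, hz, if_true]
  obtain ⟨p, hpd, hp⟩ := hc₁.exists_primitive hBd hBinf
  have hfr1 : ∀ z ∈ frontier Ω, z ∈ V₁ ∧ z ∉ poles h := fun z hz =>
    ⟨hc₁.closure_subset (frontier_subset_closure hz), (hK.eval_eq ht₀ hH (hfrK hz)).1⟩
  -- The differential is `(2/t₀)(z̄ - S)`, which is zero where `S = z̄`.
  have hrem : ∀ z ∈ frontier Ω, HasReDifferentialAt
      (remainder (potential t₀ H) (fun z => p (φ z)⁻¹) φ) 0 z := by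
    intro z hz
    obtain ⟨hzV, hzP⟩ := hfr1 z hz
    have h1 := hasReDifferentialAt_remainder (t₀ := t₀) hH hzP (hp z hzV)
      (hc₁.hasDerivAt_chart hzV) (hc₁.ne_zero hzV)
    convert! h1 using 1
    rw [hBS z hzP, hS.eq_conj z hz]
    ring
  set z₁ := ψ 1
  have hz₁ : z₁ ∈ frontier Ω := hc₁.inv_mem_frontier (by simp)
  set k : ℝ := remainder (potential t₀ H) (fun z => p (φ z)⁻¹) φ z₁ with hk
  -- As `|φ| = 1` on the boundary, `k` is the constant value of `Q - Re p(1/φ)` there; `p 0` is the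
  -- value at infinity, whose imaginary part is removed.
  set a : ℂ := k - (p 0).im * I with ha
  -- A second shrinking: `p` is bounded on the closed disc of radius `r' < r`, but possibly not on
  -- the open disc of radius `r`.
  obtain ⟨r', hr'1, hr'r⟩ := exists_between hr1
  have hc₂ := hc₁.restrict hr'1 hr'r.le
  have hsub : V₁ ∩ {z | r'⁻¹ < ‖φ z‖} ⊆ V₁ := inter_subset_left
  have hqd : ∀ z ∈ V₁, HasDerivAt (fun z => p (φ z)⁻¹ + a)
      (2 * B z - 2 * (deriv φ z / φ z)) z := fun z hz => (hp z hz).add_const a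
  refine ⟨ψ, r', V₁ ∩ {z | r'⁻¹ < ‖φ z‖}, S, fun z => p (φ z)⁻¹ + a,
    hsub.trans (inter_subset_left.trans hV'V), hc₂, hS,
    hSan.mono (sdiff_subset_sdiff_left hsub), ?_, ?_⟩
  · constructor
    · exact hc₂.isOpen
    · exact hc₂.closure_subset
    · exact fun z hz => (hqd z (hsub hz)).differentiableAt.differentiableWithinAt
    · obtain ⟨M, hM⟩ := (isCompact_closedBall (0 : ℂ) r').exists_bound_of_continuousOn
        (hpd.continuousOn.mono (Metric.closedBall_subset_ball hr'r))
      refine ⟨M + ‖a‖, fun z hz => (norm_add_le _ _).trans ?_⟩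
      gcongr
      exact hM _ (Metric.ball_subset_closedBall (hc₂.inv_mem_ball hz).1)
    · intro z hz
      have h1 := hc₁.eq_of_hasReDifferentialAt_zero hrem hz hz₁
      have h2 : ‖φ z‖ = 1 := (hc₁.frontier_iff z (hfr1 z hz).1).1 hz
      rw [← hk, remainder, h2, Real.log_one] at h1
      simp only [ha, add_re, sub_re, ofReal_re, mul_re, I_re, ofReal_im, I_im]
      linarith
    · have h1 : ContinuousAt p 0 :=
        hpd.continuousOn.continuousAt (Metric.ball_mem_nhds 0 hc₁.pos)
      have h2 := ((h1.tendsto.comp hc₁.tendsto_infinity).add_const a)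
      have h3 := (Complex.continuous_im.tendsto _).comp h2
      have h4 : (p 0 + a).im = 0 := by simp [ha]
      rw [h4] at h3
      exact h3
  · rintro z ⟨hz, hzP⟩
    have h1 := hqd z (hsub hz)
    rw [hBS z hzP] at h1
    convert! h1 using 1
    ring

end HeleShaw

/-! ### The theorem: uniqueness of the continuation and the two path formulas -/

theorem proposition3p5 (t₀ : ℝ) (ht₀ : 0 < t₀) (H : ℂ → ℝ) (h : RatFunc ℂ)
    (hH : HeleShaw.IsHarmonicWithRationalDerivative H h)
    (K : Set ℂ) (hKconn : IsConnected K)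
    (hK : HeleShaw.IsLocalDroplet (HeleShaw.potential t₀ H) K)
    (hArea : volume K = ENNReal.ofReal (Real.pi * t₀))
    (V : Set ℂ) (φ : ℂ → ℂ)
    (hφ : HeleShaw.IsExteriorConformalMap (HeleShaw.outerDomain K) V φ) :
    ∃ (V₀ : Set ℂ) (S : ℂ → ℂ),
      IsOpen V₀ ∧ closure (HeleShaw.outerDomain K) ⊆ V₀ ∧ V₀ ⊆ V ∧
      IsConnected (V₀ \ HeleShaw.poles h) ∧
      HeleShaw.IsSchwarzFunction (HeleShaw.outerDomain K) S ∧
      AnalyticOnNhd ℂ S (V₀ \ HeleShaw.poles h) ∧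
      (∃ q : ℂ → ℂ, HeleShaw.IsHarmonicContinuation (HeleShaw.potential t₀ H)
        (HeleShaw.outerDomain K) V₀ q) ∧
      ∀ (W : Set ℂ) (q : ℂ → ℂ), W ⊆ V₀ → IsConnected W →
        HeleShaw.IsHarmonicContinuation (HeleShaw.potential t₀ H)
          (HeleShaw.outerDomain K) W q →
        AnalyticOnNhd ℝ (HeleShaw.remainder (HeleShaw.potential t₀ H) q φ)
          (W \ HeleShaw.poles h) ∧
        ∀ z₀ ∈ frontier (HeleShaw.outerDomain K), ∀ z ∈ W \ HeleShaw.poles h,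
          ∀ γ : ℝ → ℂ, HeleShaw.IsPathIn (V₀ \ HeleShaw.poles h) z₀ z γ →
            HeleShaw.remainder (HeleShaw.potential t₀ H) q φ z =
                (1 / t₀) * (‖z‖ ^ 2 - ‖z₀‖ ^ 2 - 2 * (HeleShaw.pathIntegral S γ).re) ∧
              q z = q z₀
                + (2 / t₀ : ℂ) * HeleShaw.pathIntegral
                    (fun u => S u - h.eval (RingHom.id ℂ) u) γ
                - 2 * HeleShaw.pathIntegral (fun u => deriv φ u / φ u) γ := by
  open HeleShaw in
  obtain ⟨ψ, ρ, V₀, S, q₀, hV₀V, hc, hS, hSan, hq₀, hq₀d⟩ :=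
    exists_schwarz_and_continuation ht₀ hH hK hφ
  have hKc : IsCompact K := by
    obtain ⟨U, -, -, hd⟩ := hK
    exact hd.isCompact
  refine ⟨V₀, S, hc.isOpen, hc.closure_subset, hV₀V, hc.isConnected_diff (finite_poles h), hS,
    hSan, ⟨q₀, hq₀⟩, fun W q hWV hW hq => ?_⟩
  have hq₀W : IsHarmonicContinuation (potential t₀ H) (outerDomain K) W q₀ :=
    ⟨hq.isOpen, hq.closure_subset, hq₀.holomorphic.mono hWV,
      hq₀.bounded.imp fun M hM z hz => hM z (hWV hz), hq₀.re_eq, hq₀.im_infinity⟩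
  -- The path may leave `W`, so the integration is done with `q₀`, which lives on all of `V₀`; only
  -- the endpoints need to lie in `W`.
  have heq : EqOn q q₀ W := hc.eqOn_of_isHarmonicContinuation hW.isPreconnected hWV
    (isOpen_outerDomain hKc) (outerDomain_nonempty hKc) hq hq₀W
  refine ⟨fun z hz => analyticAt_remainder hH hz.2
    (hq.holomorphic.analyticAt (hq.isOpen.mem_nhds hz.1))
    (hc.holomorphic.analyticAt (hc.isOpen.mem_nhds (hWV hz.1))) (hc.ne_zero (hWV hz.1)), ?_⟩
  intro z₀ hz₀ z hz γ hγ
  have hz₀W : z₀ ∈ W := hq.closure_subset (frontier_subset_closure hz₀)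
  have hScont : ContinuousOn S (V₀ \ poles h) := hSan.continuousOn
  have hhcont : ContinuousOn (fun u => h.eval (RingHom.id ℂ) u) (V₀ \ poles h) := fun u hu =>
    (analyticAt_eval hu.2).continuousAt.continuousWithinAt
  have hφcont : ContinuousOn (fun u => deriv φ u / φ u) (V₀ \ poles h) := fun u hu =>
    (((hc.holomorphic.analyticAt (hc.isOpen.mem_nhds hu.1)).deriv.continuousAt).div
      (hc.hasDerivAt_chart hu.1).continuousAt (hc.ne_zero hu.1)).continuousWithinAt
  constructor
  -- Subtracting `|u|²/t₀` removes the non-holomorphic term `z̄`, leaving the differential of a path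
  -- integral of `S`.
  · have hR : ∀ u ∈ V₀ \ poles h, HasReDifferentialAt
        (fun u => remainder (potential t₀ H) q₀ φ u - 1 / t₀ * ‖u‖ ^ 2)
        ((-(2 / t₀ : ℂ)) * S u) u := by
      intro u hu
      have h1 := (hasReDifferentialAt_remainder (t₀ := t₀) hH hu.2 (hq₀d u hu)
        (hc.hasDerivAt_chart hu.1) (hc.ne_zero hu.1)).sub
        ((hasReDifferentialAt_norm_sq u).const_mul (1 / t₀))
      convert! h1 using 1
      push_cast
      ring
    have h2 := hγ.re_pathIntegral_eq_sub (f := fun u => -(2 / t₀ : ℂ) * S u)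
      (continuousOn_const.mul hScont) hR
    rw [IsPathIn.pathIntegral_const_mul] at h2
    have h3 : (-(2 / t₀ : ℂ) * pathIntegral S γ).re = -(2 / t₀) * (pathIntegral S γ).re := by
      rw [← re_ofReal_mul]; push_cast; rfl
    -- On the boundary `Re q₀ = Q` and `log |φ| = 0`, so no integration constant appears.
    have h4 : remainder (potential t₀ H) q₀ φ z₀ = 0 := by
      rw [remainder, hq₀.re_eq z₀ hz₀, (hc.frontier_iff z₀ (hWV hz₀W)).1 hz₀, Real.log_one]
      ring
    have h5 : remainder (potential t₀ H) q φ z = remainder (potential t₀ H) q₀ φ z := by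
      rw [remainder, remainder, heq hz.1]
    rw [h3, h4] at h2
    rw [h5]
    field_simp at h2 ⊢
    linarith
  · have hc1 : ContinuousOn (fun u => (2 / t₀ : ℂ) * (S u - h.eval (RingHom.id ℂ) u))
        (V₀ \ poles h) := continuousOn_const.mul (hScont.sub hhcont)
    have hc2 : ContinuousOn (fun u => 2 * (deriv φ u / φ u)) (V₀ \ poles h) :=
      continuousOn_const.mul hφcont
    have h1 := hγ.pathIntegral_eq_sub (f := fun u =>
      (2 / t₀ : ℂ) * (S u - h.eval (RingHom.id ℂ) u) - 2 * (deriv φ u / φ u)) (hc1.sub hc2) hq₀d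
    rw [hγ.pathIntegral_sub hc1 hc2, IsPathIn.pathIntegral_const_mul,
      IsPathIn.pathIntegral_const_mul] at h1
    rw [heq hz.1, heq hz₀W]
    linear_combination -h1
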